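/- Let $n,T,L\ge 1$ be integers. For every $t\in[0,1]$ let $w_t=(w_{t,1},\dots,w_{t,n})$ have positive entries, and put $\pi^\star(t)=w_t/\sum_i w_{t,i}$, $b(t)=\max_{i,j}w_{t,i}/w_{t,j}$ and $y^*_{ij}(t)=\frac{w_{t,j}}{w_{t,i}+w_{t,j}}$. Assume that for some $M\ge 0$ one has $|y^*_{ij}(t)-y^*_{ij}(t')|\le M|t-t'|$ for all $t,t'\in[0,1]$ and $i\ne j$. Let $\mathcal T=\{k/T: k=0,\dots,T\}$. For $t'\in\mathcal T$ let $G_{t'}\sim\mathcal G(n,p(t'))$ be independent Erdős–Rényi graphs on $[n]$ with $p_{\min}:=\min_{t'\in\mathcal T}p(t')>0$. Independently of the graphs, for each edge $\{i,j\}$ of $G_{t'}$ we observe $L$ comparisons, all comparisons being independent, in each of which $j$ wins over $i$ with probability $y^*_{ij}(t')$ (and otherwise $i$ wins over $j$); let $y_{ij}(t')$ be the proportion won by $j$. For $t\in[0,1]$ and $0<\delta\le T$ let $\mathcal N_\delta(t)=\{t'\in\mathcal T:|t-t'|\le\delta/T\}$, let $G_\delta(t)$ be the union of the graphs $G_{t'}$,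 $t'\in\mathcal N_\delta(t)$, and for an edge $\{i,j\}$ of $G_\delta(t)$ let $\bar y_{ij}(t)$ be the average of $y_{ij}(t')$ over those $t'\in\mathcal N_\delta(t)$ for which $\{i,j\}$ is an edge of $G_{t'}$. Put $p_\delta(t)=1-\prod_{t'\in\mathcal N_\delta(t)}(1-p(t'))$ and $d_\delta(t)=3np_\delta(t)$. Let $\hat P(t)$ be the $n\times n$ matrix with $\hat P_{ij}(t)=\bar y_{ij}(t)/d_\delta(t)$ for edges $\{i,j\}$ of $G_\delta(t)$, $\hat P_{ij}(t)=0$ for other pairs $i\neq j$, and with diagonal entries such that all rows sum to $1$. When $\hat P(t)$ is a stochastic matrix, $\hat\pi(t)$ denotes a stationary distribution of it, i.e. a probability vector with $\hat\pi(t)^\top\hat P(t)=\hat\pi(t)^\top$. Set $$\delta^*=\min\Big\{\frac{b(t)^{2/3}}{(2M)^{2/3}\,n\,(Lp_{\min})^{1/3}}\,T^{2/3},\;T\Big\},\qquad \beta=\min\Big\{\frac{b(t)^{2/3}}{(2M)^{2/3}n(Lp_{\min})^{1/3}T^{1/3}},\,1\Big\},\qquad \nu=\max\Big\{\frac{(2M)^{1/3}n^{1/2}(Lp_{\min})^{1/6}}{b(t)^{1/3}T^{1/3}},\,\frac1{\sqrt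 T}\Big\},$$ where for $M=0$ the first entries of the two minima are read as $+\infty$ (so $\delta^*=T$ and $\beta=1$). For every $\kappa\ge 1$ there are positive constants $c_1,c_2,c_3,C,K$, depending only on $\kappa$, such that the following holds for all data as above and all $t\in[0,1]$. Let $\delta\le T$ satisfy $\delta^*/\kappa\le\delta\le\kappa\delta^*$ (for $\kappa=1$ this says $\delta=\delta^*$). If $n\ge c_1\log n$, $\delta\ge c_2\frac{\log n}{p_{\min}}$ and $$\sqrt{\frac{\log n}{Lnp_{\min}}}\;\nu+Mn\,\beta\;\le\;\frac{c_3}{b(t)^{7/2}},$$ then with probability at least $1-Kn^{-10}$ the matrix $\hat P(t)$ is stochastic and has a stationary distribution, and every stationary distribution $\hat\pi(t)$ of it satisfies $$\frac{\|\hat\pi(t)-\pi^\star(t)\|_2}{\|\pi^\star(t)\|_2}\le C\Big(Mn\,b(t)^{7/2}\,\beta+\frac{b(t)^{9/2}}{\sqrt{Lnp_{\min}}}\;\nu\Big).$$ Moreover, on the same event: if $M>0$, then $$\frac{\|\hat\pi(t)-\pi^\star(t)\|_2}{\|\pi^\star(t)\|_2}\le C\Big(\frac{M^{1/3}b(t)^{25/6}}{(Lp_{\min})^{1/3}}+\frac{b(t)^{9/2}}{\sqrt{Lnp_{\min}}}\Big)T^{-1/3},$$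 and if $M=0$, then $$\frac{\|\hat\pi(t)-\pi^\star(t)\|_2}{\|\pi^\star(t)\|_2}\le C\,\frac{b(t)^{9/2}}{\sqrt{Lnp_{\min}T}}.$$ -/

import Mathlib

open MeasureTheory ProbabilityTheory
open scoped Matrix

noncomputable section

namespace DynRank

/-! ### The dynamic Bradley-Terry-Luce model -/

/-- The grid time `k / T`, for `k = 0, …, T`. -/
def gridPoint (T : ℕ) (k : Fin (T + 1)) : ℝ := (k : ℝ) / (T : ℝ)

/-- `y*_{ij}(t) = w_{t,j} / (w_{t,i} + w_{t,j})`, the probability that `j` wins over `i` at time `t`. -/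
def winProb {n : ℕ} (w : ℝ → Fin n → ℝ) (t : ℝ) (i j : Fin n) : ℝ :=
  w t j / (w t i + w t j)

/-- `b(t) = max_{i,j} w_{t,i} / w_{t,j}`. -/
def ratioMax {n : ℕ} (w : ℝ → Fin n → ℝ) (t : ℝ) : ℝ :=
  ⨆ ij : Fin n × Fin n, w t ij.1 / w t ij.2

/-- The normalised strength vector `π*(t) = w_t / ∑ i, w_{t,i}`. -/
def piStar {n : ℕ} (w : ℝ → Fin n → ℝ) (t : ℝ) : Fin n → ℝ :=
  fun i => w t i / ∑ k, w t k

/-- Weights are positive at every time of `[0,1]`, and the pairwise winning probabilities are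
`M`-Lipschitz in time. -/
structure IsLipschitzStrength {n : ℕ} (M : ℝ) (w : ℝ → Fin n → ℝ) : Prop where
  pos : ∀ t ∈ Set.Icc (0 : ℝ) 1, ∀ i, 0 < w t i
  lipschitz : ∀ t ∈ Set.Icc (0 : ℝ) 1, ∀ t' ∈ Set.Icc (0 : ℝ) 1, ∀ i j : Fin n, i ≠ j →
    |winProb w t i j - winProb w t' i j| ≤ M * |t - t'|

/-- Unordered pairs of distinct items, each represented with the smaller item first. -/
abbrev Pair (n : ℕ) : Type := {q : Fin n × Fin n // q.1 < q.2}

/-- The elementary events of the model: the pair `{i,j}` is compared at the `k`-th grid time, and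
`j` wins over `i` in the `l`-th comparison of `{i,j}` at the `k`-th grid time (with `i < j`). -/
def elementaryEvent {n T L : ℕ} {Ω : Type*}
    (G : Ω → Fin (T + 1) → SimpleGraph (Fin n))
    (y : Ω → Fin (T + 1) → Fin n → Fin n → Fin L → Bool) :
    (Fin (T + 1) × Pair n) ⊕ (Fin (T + 1) × Pair n × Fin L) → Set Ω
  | Sum.inl (k, q) => {ω | (G ω k).Adj q.1.1 q.1.2}
  | Sum.inr (k, q, l) => {ω | y ω k q.1.1 q.1.2 l = true}

/-- The data of the dynamic BTL model with Erdős-Rényi comparison graphs: the graphs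
`G_{k/T} ∼ 𝒢(n, p k)` are independent, and, independently of the graphs, `y ω k i j l` tells whether
`j` won over `i` in their `l`-th comparison at time `k/T`; all comparisons are independent.
(The outcomes of pairs that are not edges are never used by the estimator.) -/
structure IsDynamicBTL {n T L : ℕ} {Ω : Type*} [MeasurableSpace Ω] (μ : Measure Ω)
    (w : ℝ → Fin n → ℝ) (p : Fin (T + 1) → ℝ)
    (G : Ω → Fin (T + 1) → SimpleGraph (Fin n))
    (y : Ω → Fin (T + 1) → Fin n → Fin n → Fin L → Bool) : Prop where
  measurable : ∀ a, MeasurableSet (elementaryEvent G y a)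
  edge_prob : ∀ (k : Fin (T + 1)) (i j : Fin n), i ≠ j →
    μ {ω | (G ω k).Adj i j} = ENNReal.ofReal (p k)
  win_prob : ∀ (k : Fin (T + 1)) (i j : Fin n) (l : Fin L), i ≠ j →
    μ {ω | y ω k i j l = true} = ENNReal.ofReal (winProb w (gridPoint T k) i j)
  win_swap : ∀ (ω : Ω) (k : Fin (T + 1)) (i j : Fin n) (l : Fin L), i ≠ j →
    y ω k j i l = !(y ω k i j l)
  indep : iIndepSet (elementaryEvent G y) μ

/-! ### The estimator -/

open Classical in
/-- The neighbourhood `𝒩_δ(t)` (as a set of grid indices): grid times at distance at most `δ / T`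
from `t`. -/
def nbhd (T : ℕ) (δ t : ℝ) : Finset (Fin (T + 1)) :=
  Finset.univ.filter fun k => |t - gridPoint T k| ≤ δ / (T : ℝ)

/-- The union graph `G_δ(t)`. -/
def unionGraph {n T : ℕ} (δ t : ℝ) (g : Fin (T + 1) → SimpleGraph (Fin n)) :
    SimpleGraph (Fin n) :=
  ⨆ k ∈ nbhd T δ t, g k

open Classical in
/-- `𝒩_{ij,δ}(t)`: the times of the neighbourhood at which `i` and `j` are compared. -/
def pairTimes {n T : ℕ} (δ t : ℝ) (g : Fin (T + 1) → SimpleGraph (Fin n)) (i j : Fin n) :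
    Finset (Fin (T + 1)) :=
  (nbhd T δ t).filter fun k => (g k).Adj i j

/-- `y_{ij}(k/T)`: the proportion of the `L` comparisons at time `k/T` won by `j` over `i`. -/
def winFreq {n T L : ℕ} (z : Fin (T + 1) → Fin n → Fin n → Fin L → Bool)
    (k : Fin (T + 1)) (i j : Fin n) : ℝ :=
  (1 / (L : ℝ)) * ∑ l : Fin L, if z k i j l = true then 1 else 0

/-- `ȳ_{ij}(t)`: the average of `y_{ij}(t')` over `t' ∈ 𝒩_{ij,δ}(t)`. -/
def avgFreq {n T L : ℕ} (δ t : ℝ) (g : Fin (T + 1) → SimpleGraph (Fin n))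
    (z : Fin (T + 1) → Fin n → Fin n → Fin L → Bool) (i j : Fin n) : ℝ :=
  (1 / ((pairTimes δ t g i j).card : ℝ)) * ∑ k ∈ pairTimes δ t g i j, winFreq z k i j

open Classical in
/-- The matrix `P̂(t)` with normalisation `d`. -/
def transMatrix {n T L : ℕ} (d δ t : ℝ) (g : Fin (T + 1) → SimpleGraph (Fin n))
    (z : Fin (T + 1) → Fin n → Fin n → Fin L → Bool) : Matrix (Fin n) (Fin n) ℝ :=
  Matrix.of fun i j =>
    if i = j then
      1 - (1 / d) * ∑ k : Fin n, if (unionGraph δ t g).Adj i k then avgFreq δ t g z i k else 0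
    else if (unionGraph δ t g).Adj i j then avgFreq δ t g z i j / d
    else 0

/-- `v` is a stationary distribution (a leading left eigenvector, normalised to a probability
vector) of the transition matrix `P`. -/
structure IsStationaryDist {n : ℕ} (P : Matrix (Fin n) (Fin n) ℝ) (v : Fin n → ℝ) : Prop where
  nonneg_entries : ∀ i j, 0 ≤ P i j
  row_sum : ∀ i, ∑ j, P i j = 1
  nonneg : ∀ i, 0 ≤ v i
  sum_eq_one : ∑ i, v i = 1
  stationary : v ᵥ* P = v

/-- The Euclidean norm on `ℝⁿ`. -/
def l2norm {n : ℕ} (x : Fin n → ℝ) : ℝ := ‖(WithLp.toLp 2 x : EuclideanSpace ℝ (Fin n))‖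

/-! ### The quantities in the error bound -/

/-- `p_min = min_k p k`. -/
def pMin {T : ℕ} (p : Fin (T + 1) → ℝ) : ℝ := ⨅ k, p k

/-- `p_δ(t) = 1 - ∏_{t' ∈ 𝒩_δ(t)} (1 - p(t'))`, the edge probability of the union graph. -/
def pUnion {T : ℕ} (p : Fin (T + 1) → ℝ) (δ t : ℝ) : ℝ :=
  1 - ∏ k ∈ nbhd T δ t, (1 - p k)

/-- `δ* = min { β^{2/3} T^{2/3} / ((2M)^{2/3} n (L q)^{1/3}), T }`; for `M = 0` the first entry is
`+∞`, so that `δ* = T`. -/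
def deltaStar (n T L : ℕ) (M β q : ℝ) : ℝ :=
  if M = 0 then (T : ℝ)
  else min (β ^ (2 / 3 : ℝ) / ((2 * M) ^ (2 / 3 : ℝ) * (n : ℝ) * ((L : ℝ) * q) ^ (1 / 3 : ℝ))
      * (T : ℝ) ^ (2 / 3 : ℝ)) (T : ℝ)

/-- `min { β^{2/3} / ((2M)^{2/3} n (L q)^{1/3} T^{1/3}), 1 }`; for `M = 0` the first entry is
`+∞`, so that the minimum is `1`. -/
def biasFactor (n T L : ℕ) (M β q : ℝ) : ℝ :=
  if M = 0 then 1
  else min (β ^ (2 / 3 : ℝ) / ((2 * M) ^ (2 / 3 : ℝ) * (n : ℝ) * ((L : ℝ) * q) ^ (1 / 3 : ℝ)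
      * (T : ℝ) ^ (1 / 3 : ℝ))) 1

/-- `max { (2M)^{1/3} n^{1/2} (L q)^{1/6} / (β^{1/3} T^{1/3}), 1 / √T }`. -/
def varFactor (n T L : ℕ) (M β q : ℝ) : ℝ :=
  max ((2 * M) ^ (1 / 3 : ℝ) * (n : ℝ) ^ (1 / 2 : ℝ) * ((L : ℝ) * q) ^ (1 / 6 : ℝ)
    / (β ^ (1 / 3 : ℝ) * (T : ℝ) ^ (1 / 3 : ℝ))) (1 / √(T : ℝ))

/-- The left-hand side of the condition on `T`. -/
def condLHS (n T L : ℕ) (M β q : ℝ) : ℝ :=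
  √(Real.log n / ((L : ℝ) * n * q)) * varFactor n T L M β q
    + M * n * biasFactor n T L M β q

/-- The explicit error bound, up to a constant. -/
def errBound (n T L : ℕ) (M β q : ℝ) : ℝ :=
  M * n * β ^ (7 / 2 : ℝ) * biasFactor n T L M β q
    + β ^ (9 / 2 : ℝ) / √((L : ℝ) * n * q) * varFactor n T L M β q

end DynRank

end

open DynRank

open DynRank

namespace DynRank

/-! ### Euclidean norm -/

section Norm

variable {n : ℕ}

/-! A stationary vector of the estimated chain balances the flow of mass under the off-diagonal
rates, and the normalisation cancels from this balance. Since `δ * p_min` dominates `log n`, with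
high probability every pair is compared at least `m = p_min * δ / 8` times in the window. The union
graph is then complete, and every rate is the true rate `w j / (w i + w j)` plus a bias `B` plus a
noise `E` (`rate_eq`). The Lipschitz assumption gives `|B| ≤ M * δ / T`.

The unperturbed chain is reversible on the complete graph, and its Dirichlet form yields the
stability estimate `l2norm_le_flux`. In `l2norm_sub_le_of_flux_eq_zero` the perturbation acts on `v
= (v - π) + π`. The part acting on `v - π` is absorbed by the smallness condition, which tolerates a
bound on the row sums of `E` carrying a `log n`. The part acting on `π` needs only the operator norm
of `E`, because the entries of `π` are comparable to each other; so the final error has no `log n`.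

Conditionally on the graphs, a bilinear form in `E` is a linear form in independent centred
indicators. Hoeffding's inequality with a union bound over a net gives operator norm of order `√(n /
(m L))`, and over the rows it gives row sums of order `√(n log n / (m L))`. Finally `δ` is within
`κ` of `δ*`, and the two factors of the error bound are exactly `δ* / T` and `1 / √δ*`
(`biasFactor_eq`, `varFactor_eq`). -/

lemma l2norm_sq (x : Fin n → ℝ) : l2norm x ^ 2 = ∑ i, x i ^ 2 := by
  simp [l2norm, EuclideanSpace.norm_sq_eq]

lemma l2norm_nonneg (x : Fin n → ℝ) : 0 ≤ l2norm x := norm_nonneg _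

lemma l2norm_add_le (x y : Fin n → ℝ) : l2norm (x + y) ≤ l2norm x + l2norm y := by
  simpa [l2norm] using norm_add_le (WithLp.toLp 2 x : EuclideanSpace ℝ (Fin n)) (WithLp.toLp 2 y)

lemma l2norm_sub_le (x y : Fin n → ℝ) : l2norm (x - y) ≤ l2norm x + l2norm y := by
  simpa [l2norm] using norm_sub_le (WithLp.toLp 2 x : EuclideanSpace ℝ (Fin n)) (WithLp.toLp 2 y)

lemma l2norm_le_of_abs_le {x y : Fin n → ℝ} {c : ℝ} (hc : 0 ≤ c) (h : ∀ i, |x i| ≤ c * |y i|) :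
    l2norm x ≤ c * l2norm y := by
  refine le_of_sq_le_sq ?_ (mul_nonneg hc (l2norm_nonneg y))
  rw [mul_pow, l2norm_sq, l2norm_sq, Finset.mul_sum]
  refine Finset.sum_le_sum fun i _ => ?_
  have := pow_le_pow_left₀ (abs_nonneg _) (h i) 2
  rwa [mul_pow, sq_abs, sq_abs] at this

lemma sum_mul_le_l2norm (x y : Fin n → ℝ) : ∑ i, x i * y i ≤ l2norm x * l2norm y := by
  have h := Finset.sum_mul_sq_le_sq_mul_sq Finset.univ x y
  rw [← l2norm_sq, ← l2norm_sq, ← mul_pow] at h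
  exact (le_abs_self _).trans (abs_le_of_sq_le_sq h
    (mul_nonneg (l2norm_nonneg x) (l2norm_nonneg y)))

lemma l2norm_const (c : ℝ) : l2norm (fun _ : Fin n => c) = √n * |c| := by
  rw [← Real.sqrt_sq (l2norm_nonneg _), l2norm_sq]
  simp [Real.sqrt_mul, Real.sqrt_sq_eq_abs]

lemma sum_abs_le_l2norm (x : Fin n → ℝ) : ∑ i, |x i| ≤ √n * l2norm x := by
  have h := sum_mul_le_l2norm (fun _ : Fin n => (1 : ℝ)) (fun i => |x i|)
  have h2 : l2norm (fun i => |x i|) = l2norm x := by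
    rw [← Real.sqrt_sq (l2norm_nonneg _), l2norm_sq, ← Real.sqrt_sq (l2norm_nonneg x), l2norm_sq]
    simp
  rw [l2norm_const, h2] at h
  simpa using h

end Norm

/-! ### Stationary distributions -/

/-- The constants are fixed on the right, so `P - 1` is singular and has a left null vector `v`.
Entrywise `|v| ≤ |v| P`, and both sides have the same total mass, so equality holds and `|v|` can be
normalised. -/
lemma exists_isStationaryDist {n : ℕ} (hn : 0 < n) {P : Matrix (Fin n) (Fin n) ℝ}
    (h0 : ∀ i j, 0 ≤ P i j) (h1 : ∀ i, ∑ j, P i j = 1) : ∃ v, IsStationaryDist P v := by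
  have : NeZero n := ⟨hn.ne'⟩
  have hdet : (P - 1).det = 0 := by
    rw [← Matrix.exists_mulVec_eq_zero_iff]
    refine ⟨fun _ => 1, fun h => one_ne_zero (congrFun h (0 : Fin n)), ?_⟩
    ext i
    rw [Matrix.sub_mulVec, Matrix.one_mulVec]
    simp [Matrix.mulVec, dotProduct, h1]
  obtain ⟨v, hv0, hv⟩ := Matrix.exists_vecMul_eq_zero_iff.2 hdet
  rw [Matrix.vecMul_sub, Matrix.vecMul_one, sub_eq_zero] at hv
  have hle : ∀ j, |v j| ≤ ∑ i, |v i| * P i j := fun j => by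
    calc |v j| = |∑ i, v i * P i j| := by rw [← congrFun hv j]; rfl
      _ ≤ ∑ i, |v i * P i j| := Finset.abs_sum_le_sum_abs _ _
      _ = _ := by simp_rw [abs_mul, abs_of_nonneg (h0 _ _)]
  have hsum : ∑ j, |v j| = ∑ j, ∑ i, |v i| * P i j := by
    rw [Finset.sum_comm]
    simp_rw [← Finset.mul_sum, h1, mul_one]
  have heq : ∀ j, |v j| = ∑ i, |v i| * P i j := fun j =>
    (Finset.sum_eq_sum_iff_of_le fun i _ => hle i).1 hsum j (Finset.mem_univ j)
  have hpos : 0 < ∑ i, |v i| := by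
    obtain ⟨i, hi⟩ := Function.ne_iff.1 hv0
    exact Finset.sum_pos' (fun _ _ => abs_nonneg _) ⟨i, Finset.mem_univ _, abs_pos.2 hi⟩
  refine ⟨fun j => |v j| / ∑ i, |v i|, h0, h1, fun i => by positivity, ?_, ?_⟩
  · rw [← Finset.sum_div, div_self hpos.ne']
  · ext j
    simp only [Matrix.vecMul, dotProduct]
    rw [heq j, Finset.sum_div]
    exact Finset.sum_congr rfl fun i _ => by ring

/-! ### Perturbation of the balance equations -/

section Flux

variable {n : ℕ}

/-- The net flow into `j` of the mass `v` under the rates `D`. -/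
noncomputable def flux (D : Fin n → Fin n → ℝ) (v : Fin n → ℝ) (j : Fin n) : ℝ :=
  ∑ i, (v i * D i j - v j * D j i)

lemma flux_add_right (D : Fin n → Fin n → ℝ) (u v : Fin n → ℝ) :
    flux D (u + v) = flux D u + flux D v := by
  ext j
  simp only [flux, Pi.add_apply, ← Finset.sum_add_distrib]
  exact Finset.sum_congr rfl fun i _ => by ring

/-- The variance identity: the cross term in the expanded square is `(∑ w f)²`, which vanishes. -/
lemma sum_sum_mul_sq_sub (w f : Fin n → ℝ) (h : ∑ i, w i * f i = 0) :
    ∑ j, ∑ i, w i * w j * (f i - f j) ^ 2 = 2 * (∑ i, w i) * ∑ i, w i * f i ^ 2 := by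
  have e : ∀ j i, w i * w j * (f i - f j) ^ 2 =
      w j * (w i * f i ^ 2) + (w j * f j ^ 2) * w i - 2 * ((w j * f j) * (w i * f i)) := by
    intros; ring
  simp_rw [e, Finset.sum_sub_distrib, Finset.sum_add_distrib, ← Finset.mul_sum, ← Finset.sum_mul, h]
  ring

/-- The spectral gap of the complete comparison graph, as a stability estimate. -/
lemma l2norm_le_flux {w : Fin n → ℝ} (hn : 0 < n) (hw : ∀ i, 0 < w i) {b : ℝ}
    (hb : ∀ i j, w i ≤ b * w j) {x g : Fin n → ℝ} (hx : ∑ i, x i = 0)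
    (hg : ∀ j, flux (fun i j => w j / (w i + w j)) x j + g j = 0) :
    n * l2norm x ≤ 2 * b ^ 2 * l2norm g := by
  have : NeZero n := ⟨hn.ne'⟩
  obtain ⟨i₀, -, hi₀⟩ := Finset.exists_min_image Finset.univ w Finset.univ_nonempty
  set a := w i₀ with ha
  have ha0 : 0 < a := hw _
  have hmin : ∀ i, a ≤ w i := fun i => hi₀ i (Finset.mem_univ _)
  have hmax : ∀ i, w i ≤ b * a := fun i => hb i _
  have hb0 : 0 < b := pos_of_mul_pos_left (ha0.trans_le (hmax i₀)) ha0.le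
  -- By reversibility, in terms of the density `f = x / w` the flux is a graph Laplacian with
  -- symmetric conductances `H`.
  set f : Fin n → ℝ := fun i => x i / w i with hf
  have hxf : ∀ i, x i = w i * f i := fun i => by
    rw [hf]; field_simp [(hw i).ne']
  set H : Fin n → Fin n → ℝ := fun i j => w i * w j / (w i + w j) with hH
  have hflux : ∀ j, flux (fun i j => w j / (w i + w j)) x j = ∑ i, H i j * (f i - f j) := by
    intro j
    refine Finset.sum_congr rfl fun i _ => ?_
    have := (add_pos (hw i) (hw j)).ne'
    simp only [hH]
    rw [hxf i, hxf j, add_comm (w j) (w i)]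
    field_simp
  -- Summation by parts: pairing the equation with `f` produces the Dirichlet form.
  have hdir : ∑ j, f j * g j = 1 / 2 * ∑ j, ∑ i, H i j * (f i - f j) ^ 2 := by
    have e1 : ∑ j, f j * g j = -∑ j, ∑ i, H i j * (f i - f j) * f j := by
      rw [← Finset.sum_neg_distrib]
      refine Finset.sum_congr rfl fun j _ => ?_
      rw [eq_neg_of_add_eq_zero_right (hg j), hflux, ← Finset.sum_mul]
      ring
    have e2 : ∑ j, ∑ i, H i j * (f i - f j) * f j = - ∑ j, ∑ i, H i j * (f i - f j) * f i := by
      rw [Finset.sum_comm, ← Finset.sum_neg_distrib]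
      refine Finset.sum_congr rfl fun j _ => ?_
      rw [← Finset.sum_neg_distrib]
      refine Finset.sum_congr rfl fun i _ => ?_
      simp only [hH]
      rw [add_comm (w j) (w i)]
      ring
    have e3 : ∑ j, ∑ i, H i j * (f i - f j) ^ 2 =
        ∑ j, ∑ i, H i j * (f i - f j) * f i - ∑ j, ∑ i, H i j * (f i - f j) * f j := by
      simp_rw [← Finset.sum_sub_distrib]
      exact Finset.sum_congr rfl fun j _ => Finset.sum_congr rfl fun i _ => by ring
    linarith
  -- As `w i + w j ≤ 2 b a`, the conductances dominate a multiple of the product weights, whose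
  -- Dirichlet form is a variance.
  have hlow : ∑ j, ∑ i, w i * w j * (f i - f j) ^ 2 ≤
      2 * (b * a) * ∑ j, ∑ i, H i j * (f i - f j) ^ 2 := by
    simp_rw [Finset.mul_sum]
    refine Finset.sum_le_sum fun j _ => Finset.sum_le_sum fun i _ => ?_
    have h1 : w i * w j ≤ 2 * (b * a) * H i j := by
      simp only [hH]
      rw [mul_div_assoc', le_div_iff₀ (add_pos (hw i) (hw j)), mul_comm]
      have := mul_pos (hw i) (hw j)
      gcongr
      linarith [hmax i, hmax j]
    calc w i * w j * (f i - f j) ^ 2 ≤ 2 * (b * a) * H i j * (f i - f j) ^ 2 := by gcongr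
      _ = _ := by ring
  rw [sum_sum_mul_sq_sub w f (by simp_rw [← hxf]; exact hx)] at hlow
  have hW : n * a ≤ ∑ i, w i := by
    simpa using Finset.card_nsmul_le_sum Finset.univ w a (fun i _ => hmin i)
  have hE : l2norm x ^ 2 ≤ b * a * ∑ i, w i * f i ^ 2 := by
    rw [l2norm_sq, Finset.mul_sum]
    refine Finset.sum_le_sum fun i _ => ?_
    rw [hxf i]
    have := hw i
    calc (w i * f i) ^ 2 = w i * (w i * f i ^ 2) := by ring
      _ ≤ _ := by gcongr; exact hmax i
  -- Since `a` is the least weight, `|a f| ≤ |x|`; returning from `f` to `x` here costs no factor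
  -- `b`.
  have hR : a * ∑ j, f j * g j ≤ l2norm x * l2norm g := by
    have h1 : ∑ j, (a * f j) * g j ≤ l2norm (fun j => a * f j) * l2norm g := sum_mul_le_l2norm _ _
    have h2 : l2norm (fun j => a * f j) ≤ 1 * l2norm x := by
      refine l2norm_le_of_abs_le zero_le_one fun i => ?_
      rw [hxf i, abs_mul, abs_mul, abs_of_pos ha0, abs_of_pos (hw i), one_mul]
      gcongr
      exact hmin i
    rw [one_mul] at h2
    calc a * ∑ j, f j * g j = ∑ j, (a * f j) * g j := by
          rw [Finset.mul_sum]; exact Finset.sum_congr rfl fun i _ => by ring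
      _ ≤ _ := h1.trans (by gcongr; exact l2norm_nonneg g)
  have hS : 0 ≤ ∑ i, w i * f i ^ 2 :=
    Finset.sum_nonneg fun i _ => mul_nonneg (hw i).le (sq_nonneg _)
  have key : n * l2norm x ^ 2 ≤ 2 * b ^ 2 * (l2norm x * l2norm g) := by
    have k1 : n * a * (∑ i, w i * f i ^ 2) ≤ 2 * (b * a) * ∑ j, f j * g j := by
      have := mul_le_mul_of_nonneg_right hW hS
      rw [hdir]
      linarith
    have k2 : (n : ℝ) * l2norm x ^ 2 ≤ n * (b * a * ∑ i, w i * f i ^ 2) := by gcongr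
    have k3 : b * (n * a * (∑ i, w i * f i ^ 2)) ≤ b * (2 * (b * a) * ∑ j, f j * g j) := by gcongr
    have k4 : 2 * b ^ 2 * (a * ∑ j, f j * g j) ≤ 2 * b ^ 2 * (l2norm x * l2norm g) := by gcongr
    linarith
  rcases (l2norm_nonneg x).eq_or_lt with h0 | h0
  · rw [← h0, mul_zero]
    exact mul_nonneg (by positivity) (l2norm_nonneg g)
  · refine le_of_mul_le_mul_right ?_ h0
    linarith

lemma l2norm_flux_le_of_abs_le {B : Fin n → Fin n → ℝ} {η : ℝ} (hη : 0 ≤ η)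
    (hB : ∀ i j, |B i j| ≤ η) (v : Fin n → ℝ) :
    l2norm (flux B v) ≤ 2 * n * η * l2norm v := by
  have hdec : flux B v = (fun j => ∑ i, v i * B i j) - fun j => v j * ∑ i, B j i := by
    ext j
    simp [flux, Finset.sum_sub_distrib, Finset.mul_sum]
  have h1 : l2norm (fun j => ∑ i, v i * B i j) ≤ n * η * l2norm v := by
    have : l2norm (fun j => ∑ i, v i * B i j) ≤ η * l2norm (fun _ : Fin n => ∑ i, |v i|) := by
      refine l2norm_le_of_abs_le hη fun j => ?_
      rw [abs_of_nonneg (Finset.sum_nonneg fun i _ => abs_nonneg (v i)), Finset.mul_sum]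
      refine (Finset.abs_sum_le_sum_abs _ _).trans (Finset.sum_le_sum fun i _ => ?_)
      rw [abs_mul, mul_comm]
      gcongr
      exact hB i j
    rw [l2norm_const, abs_of_nonneg (Finset.sum_nonneg fun i _ => abs_nonneg (v i))] at this
    calc _ ≤ _ := this
      _ ≤ η * (√n * (√n * l2norm v)) := by gcongr; exact sum_abs_le_l2norm v
      _ = η * ((√n * √n) * l2norm v) := by ring
      _ = _ := by rw [Real.mul_self_sqrt (Nat.cast_nonneg n)]; ring
  have h2 : l2norm (fun j => v j * ∑ i, B j i) ≤ n * η * l2norm v := by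
    refine l2norm_le_of_abs_le (by positivity) fun j => ?_
    rw [abs_mul, mul_comm]
    gcongr
    refine (Finset.abs_sum_le_sum_abs _ _).trans ?_
    simpa using Finset.sum_le_card_nsmul Finset.univ (fun i => |B j i|) η (fun i _ => hB j i)
  rw [hdec]
  linarith [l2norm_sub_le (fun j => ∑ i, v i * B i j) (fun j => v j * ∑ i, B j i)]

lemma flux_eq_vecMul_sub (E : Fin n → Fin n → ℝ) (v : Fin n → ℝ) :
    flux E v = v ᵥ* Matrix.of E - fun j => v j * ∑ i, E j i := by
  ext j
  simp [flux, Finset.sum_sub_distrib, Finset.mul_sum, Matrix.vecMul, dotProduct]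

/-- For an arbitrary `v` the outflow is a diagonal operator, so the row sums must be bounded
uniformly. This costs a logarithm and is applied only to `v - π`. -/
lemma l2norm_flux_le_of_opNorm_le {E : Fin n → Fin n → ℝ} {s s' : ℝ} (hs' : 0 ≤ s')
    (hE : ∀ v, l2norm (v ᵥ* Matrix.of E) ≤ s * l2norm v) (hr : ∀ i, |∑ j, E i j| ≤ s')
    (v : Fin n → ℝ) : l2norm (flux E v) ≤ (s + s') * l2norm v := by
  have h2 : l2norm (fun j => v j * ∑ i, E j i) ≤ s' * l2norm v := by
    refine l2norm_le_of_abs_le hs' fun j => ?_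
    rw [abs_mul, mul_comm]
    gcongr
    exact hr j
  rw [flux_eq_vecMul_sub]
  linarith [l2norm_sub_le (v ᵥ* Matrix.of E) (fun j => v j * ∑ i, E j i), hE v]

/-- When the entries of `v` are comparable, the outflow needs only the Euclidean norm of the vector
of row sums. By antisymmetry this vector is, up to sign, the all-ones row vector times `E`, so its
norm is at most `s * √n`. -/
lemma l2norm_flux_le_of_le_mul {E : Fin n → Fin n → ℝ} {s b : ℝ} (hn : 0 < n)
    (hE : ∀ v, l2norm (v ᵥ* Matrix.of E) ≤ s * l2norm v) (hanti : ∀ i j, E i j = -E j i)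
    {v : Fin n → ℝ} (hv : ∀ i, 0 ≤ v i) (hb0 : 0 ≤ b) (hb : ∀ i j, v i ≤ b * v j) :
    l2norm (flux E v) ≤ (s + b * s) * l2norm v := by
  have : NeZero n := ⟨hn.ne'⟩
  obtain ⟨i₀, -, hi₀⟩ := Finset.exists_min_image Finset.univ v Finset.univ_nonempty
  have hone : (fun j => ∑ i, E j i) = -((fun _ => 1) ᵥ* Matrix.of E) := by
    ext j
    simp only [Matrix.vecMul, dotProduct, Pi.neg_apply, one_mul, Matrix.of_apply]
    rw [← Finset.sum_neg_distrib]
    exact Finset.sum_congr rfl fun i _ => hanti j i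
  have hrow : l2norm (fun j => ∑ i, E j i) ≤ s * √n := by
    have := hE (fun _ => 1)
    rw [l2norm_const, abs_one, mul_one] at this
    rwa [hone, l2norm, WithLp.toLp_neg, norm_neg]
  have hs : 0 ≤ s * √n := (l2norm_nonneg _).trans hrow
  have hmin : √n * v i₀ ≤ l2norm v := by
    have h := l2norm_le_of_abs_le (x := fun _ : Fin n => v i₀) (y := v) zero_le_one fun i => by
      rw [one_mul, abs_of_nonneg (hv _), abs_of_nonneg (hv _)]
      exact hi₀ i (Finset.mem_univ _)
    rwa [l2norm_const, abs_of_nonneg (hv _), one_mul] at h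
  have hs0 : 0 ≤ s := by
    have : 0 < √(n : ℝ) := Real.sqrt_pos.2 (Nat.cast_pos.2 hn)
    exact nonneg_of_mul_nonneg_left hs this
  have h2 : l2norm (fun j => v j * ∑ i, E j i) ≤ b * s * l2norm v := by
    have h := l2norm_le_of_abs_le (x := fun j => v j * ∑ i, E j i) (y := fun j => ∑ i, E j i)
      (c := b * v i₀) (mul_nonneg hb0 (hv _)) fun j => by
        rw [abs_mul, abs_of_nonneg (hv _)]
        gcongr
        exact hb j i₀
    calc _ ≤ _ := h
      _ ≤ b * v i₀ * (s * √n) := by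
          gcongr
          exact mul_nonneg hb0 (hv _)
      _ = b * s * (√n * v i₀) := by ring
      _ ≤ _ := by gcongr
  rw [flux_eq_vecMul_sub]
  linarith [l2norm_sub_le (v ᵥ* Matrix.of E) (fun j => v j * ∑ i, E j i), hE v]

/-- If the rates `Y` are the Bradley-Terry-Luce rates of `w` up to a small bias `B` and an
antisymmetric noise `E`, then a balanced probability vector for `Y` is close to `w / ∑ w`. -/
theorem l2norm_sub_le_of_flux_eq_zero {w : Fin n → ℝ} (hn : 0 < n) (hw : ∀ i, 0 < w i) {b : ℝ}
    (hb : ∀ i j, w i ≤ b * w j) {Y B E : Fin n → Fin n → ℝ} {η s s' : ℝ}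
    (hY : ∀ i j, i ≠ j → Y i j = w j / (w i + w j) + (B i j + E i j))
    (hB : ∀ i j, |B i j| ≤ η) (hanti : ∀ i j, E i j = -E j i)
    (hE : ∀ v, l2norm (v ᵥ* Matrix.of E) ≤ s * l2norm v) (hr : ∀ i, |∑ j, E i j| ≤ s')
    (hsmall : 4 * b ^ 2 * (2 * n * η + s + s') ≤ n)
    {v : Fin n → ℝ} (hv1 : ∑ i, v i = 1) (hv : ∀ j, flux Y v j = 0) :
    n * l2norm (v - fun i => w i / ∑ k, w k) ≤
      4 * b ^ 2 * (2 * n * η + (s + b * s)) * l2norm (fun i => w i / ∑ k, w k) := by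
  have i₀ : Fin n := ⟨0, hn⟩
  have hη : 0 ≤ η := (abs_nonneg _).trans (hB i₀ i₀)
  have hs' : 0 ≤ s' := (abs_nonneg _).trans (hr i₀)
  have hb0 : 0 < b := pos_of_mul_pos_left ((hw i₀).trans_le (hb i₀ i₀)) (hw i₀).le
  have hW : 0 < ∑ k, w k := Finset.sum_pos (fun i _ => hw i) ⟨i₀, Finset.mem_univ _⟩
  set π : Fin n → ℝ := fun i => w i / ∑ k, w k with hπ
  have hvx : v = (v - π) + π := by simp
  have hbal : ∀ j, flux (fun i j => w j / (w i + w j)) π j = 0 := fun j => by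
    refine Finset.sum_eq_zero fun i _ => ?_
    simp only [hπ]
    rw [add_comm (w j) (w i)]
    ring
  have hsplit : ∀ j, flux Y v j = flux (fun i j => w j / (w i + w j)) v j +
      (flux B v j + flux E v j) := fun j => by
    simp only [flux, ← Finset.sum_add_distrib]
    refine Finset.sum_congr rfl fun i _ => ?_
    rcases eq_or_ne i j with rfl | hij
    · simp
    · rw [hY i j hij, hY j i hij.symm]
      ring
  have hx0 : ∑ i, (v - π) i = 0 := by
    simp only [Pi.sub_apply, Finset.sum_sub_distrib, hv1, hπ]
    rw [← Finset.sum_div, div_self hW.ne', sub_self]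
  have h := l2norm_le_flux hn hw hb (x := v - π) (g := flux B v + flux E v) hx0 fun j => by
    have h1 := hsplit j
    rw [hv j] at h1
    have h2 := congrFun (flux_add_right (fun i j => w j / (w i + w j)) (v - π) π) j
    rw [← hvx, Pi.add_apply, hbal j, add_zero] at h2
    rw [← h2, Pi.add_apply]
    exact h1.symm
  have hπ0 : ∀ i, 0 ≤ π i := fun i => (div_pos (hw i) hW).le
  have hπb : ∀ i j, π i ≤ b * π j := fun i j => by
    simp only [hπ]
    rw [mul_div_assoc']
    gcongr
    exact hb i j
  have hBE : l2norm (flux B v + flux E v) ≤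
      (2 * n * η + s + s') * l2norm (v - π) + (2 * n * η + (s + b * s)) * l2norm π := by
    rw [hvx, flux_add_right, flux_add_right]
    simp only [← hvx]
    have a1 := l2norm_add_le (flux B (v - π) + flux B π) (flux E (v - π) + flux E π)
    have a2 := l2norm_add_le (flux B (v - π)) (flux B π)
    have a3 := l2norm_add_le (flux E (v - π)) (flux E π)
    have a4 := l2norm_flux_le_of_abs_le hη hB (v - π)
    have a5 := l2norm_flux_le_of_abs_le hη hB π
    have a6 := l2norm_flux_le_of_opNorm_le hs' hE hr (v - π)
    have a7 := l2norm_flux_le_of_le_mul hn hE hanti hπ0 hb0.le hπb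
    linarith
  have h3 : 2 * b ^ 2 * l2norm (flux B v + flux E v) ≤ 2 * b ^ 2 *
      ((2 * n * η + s + s') * l2norm (v - π) + (2 * n * η + (s + b * s)) * l2norm π) := by gcongr
  -- Smallness bounds the coefficient of `l2norm (v - π)` on the right by `n / 2`; absorbing it
  -- doubles the constant `2 * b ^ 2`.
  have h4 := mul_le_mul_of_nonneg_right hsmall (l2norm_nonneg (v - π))
  linarith

end Flux

/-! ### Nets of the Euclidean ball -/

section Net

variable {n : ℕ}

/-- A 1-separated subset of maximal cardinality is a net, since an uncovered point could be added.
Radius 2 and separation 1 are the scales of `Besicovitch.card_le_of_separated`. -/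
lemma exists_net (n : ℕ) : ∃ N : Finset (EuclideanSpace ℝ (Fin n)), N.card ≤ 5 ^ n ∧
    (∀ c ∈ N, ‖c‖ ≤ 2) ∧ ∀ x : EuclideanSpace ℝ (Fin n), ‖x‖ ≤ 2 → ∃ c ∈ N, ‖x - c‖ ≤ 1 := by
  classical
  let Sep : Finset (EuclideanSpace ℝ (Fin n)) → Prop := fun s =>
    (∀ c ∈ s, ‖c‖ ≤ 2) ∧ ∀ c ∈ s, ∀ d ∈ s, c ≠ d → 1 ≤ ‖c - d‖
  have hcard : ∀ s, Sep s → s.card ≤ 5 ^ n := fun s hs => by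
    simpa using Besicovitch.card_le_of_separated s hs.1 hs.2
  let K : Set ℕ := {k | ∃ s, Sep s ∧ s.card = k}
  have hne : K.Nonempty := ⟨0, ∅, ⟨by simp, by simp⟩, rfl⟩
  have hbdd : BddAbove K := ⟨5 ^ n, by rintro k ⟨s, hs, rfl⟩; exact hcard s hs⟩
  obtain ⟨N, hN, hNc⟩ := Nat.sSup_mem hne hbdd
  refine ⟨N, hcard N hN, hN.1, fun x hx => ?_⟩
  by_contra! hfar
  have hxN : x ∉ N := fun h => by
    have := hfar x h
    simp at this
    linarith
  have hins : Sep (insert x N) := by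
    refine ⟨?_, ?_⟩
    · intro c hc
      rcases Finset.mem_insert.1 hc with rfl | hc
      exacts [hx, hN.1 c hc]
    · intro c hc d hd hcd
      rcases Finset.mem_insert.1 hc with hc' | hc' <;>
        rcases Finset.mem_insert.1 hd with hd' | hd'
      · exact absurd (hc'.trans hd'.symm) hcd
      · exact hc' ▸ (hfar d hd').le
      · rw [norm_sub_rev]; exact hd' ▸ (hfar c hc').le
      · exact hN.2 c hc' d hd' hcd
  have := le_csSup hbdd ⟨_, hins, rfl⟩
  rw [Finset.card_insert_of_notMem hxN, hNc] at this
  omega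

/-- The operator norm of a matrix is controlled by its bilinear form on a net. -/
lemma l2norm_vecMul_le_of_net {N : Finset (EuclideanSpace ℝ (Fin n))}
    (hN : ∀ x : EuclideanSpace ℝ (Fin n), ‖x‖ ≤ 2 → ∃ c ∈ N, ‖x - c‖ ≤ 1)
    {E : Fin n → Fin n → ℝ} {s : ℝ} (hs : 0 ≤ s)
    (hE : ∀ u ∈ N, ∀ v ∈ N, ∑ i, ∑ j, u i * E i j * v j ≤ s) (v : Fin n → ℝ) :
    l2norm (v ᵥ* Matrix.of E) ≤ s * l2norm v := by
  -- Scale `y` to norm 2 and take a net point `c` within distance 1: the inner product with `c` is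
  -- at least `2‖y‖ - ‖y‖`.
  have hdual : ∀ y : EuclideanSpace ℝ (Fin n), ∃ c ∈ N, ‖y‖ ≤ inner ℝ y c := fun y => by
    rcases eq_or_ne y 0 with rfl | hy
    · obtain ⟨c, hc, -⟩ := hN 0 (by simp)
      exact ⟨c, hc, by simp⟩
    have hy' : 0 < ‖y‖ := norm_pos_iff.2 hy
    obtain ⟨c, hc, hcd⟩ := hN ((2 / ‖y‖) • y) (by
      rw [norm_smul, Real.norm_of_nonneg (by positivity), div_mul_cancel₀ _ hy'.ne'])
    refine ⟨c, hc, ?_⟩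
    have h1 : inner ℝ y ((2 / ‖y‖) • y) = 2 * ‖y‖ := by
      rw [inner_smul_right, real_inner_self_eq_norm_sq]
      field_simp
    have h2 : inner ℝ y ((2 / ‖y‖) • y) = inner ℝ y ((2 / ‖y‖) • y - c) + inner ℝ y c := by
      rw [← inner_add_right, sub_add_cancel]
    have h3 := real_inner_le_norm y ((2 / ‖y‖) • y - c)
    have h4 : ‖y‖ * ‖(2 / ‖y‖) • y - c‖ ≤ ‖y‖ * 1 := by gcongr
    linarith
  let A : EuclideanSpace ℝ (Fin n) →L[ℝ] EuclideanSpace ℝ (Fin n) :=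
    Matrix.toEuclideanCLM (𝕜 := ℝ) (Matrix.of E)ᵀ
  have hA : ∀ v : Fin n → ℝ, A (WithLp.toLp 2 v) = WithLp.toLp 2 (v ᵥ* Matrix.of E) := fun v => by
    simp [A, Matrix.mulVec_transpose]
  have hnet : ∀ c ∈ N, ‖A c‖ ≤ s := fun c hc => by
    obtain ⟨d, hd, h⟩ := hdual (A c)
    refine h.trans (le_trans (le_of_eq ?_) (hE c hc d hd))
    have hc' : A c = WithLp.toLp 2 (c.ofLp ᵥ* Matrix.of E) := by rw [← hA]
    rw [hc', PiLp.inner_apply, Finset.sum_comm]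
    refine Finset.sum_congr rfl fun j _ => ?_
    simp [Matrix.vecMul, dotProduct, Finset.mul_sum, mul_comm]
  have hop : ‖A‖ ≤ s := by
    -- The net bounds `A` on vectors of norm 2 by `s + ‖A‖`; the self-referential inequality then
    -- closes.
    have hle : ‖A‖ ≤ (s + ‖A‖) / 2 := by
      refine A.opNorm_le_bound (by positivity) fun x => ?_
      rcases eq_or_ne x 0 with rfl | hx
      · simp
      have hx' : 0 < ‖x‖ := norm_pos_iff.2 hx
      obtain ⟨c, hc, hcd⟩ := hN ((2 / ‖x‖) • x) (by
        rw [norm_smul, Real.norm_of_nonneg (by positivity), div_mul_cancel₀ _ hx'.ne'])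
      have h1 : ‖A ((2 / ‖x‖) • x)‖ ≤ s + ‖A‖ := by
        rw [← sub_add_cancel ((2 / ‖x‖) • x) c, map_add]
        have h2 := norm_add_le (A ((2 / ‖x‖) • x - c)) (A c)
        have h3 := A.le_opNorm ((2 / ‖x‖) • x - c)
        have h4 : ‖A‖ * ‖(2 / ‖x‖) • x - c‖ ≤ ‖A‖ * 1 := by gcongr
        linarith [hnet c hc]
      rw [map_smul, norm_smul, Real.norm_of_nonneg (by positivity), div_mul_eq_mul_div,
        div_le_iff₀ hx'] at h1
      linarith
    linarith
  have h := A.le_opNorm (WithLp.toLp 2 v)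
  rw [hA] at h
  exact h.trans (mul_le_mul_of_nonneg_right hop (norm_nonneg _))

end Net

/-! ### Concentration for independent events -/

section Concentration

variable {Ω ι : Type*} [MeasurableSpace Ω] {μ : Measure Ω} [IsProbabilityMeasure μ]

lemma mgf_indicator_one {A : Set Ω} (hA : MeasurableSet A) (r : ℝ) :
    mgf (A.indicator fun _ => (1 : ℝ)) μ r = 1 + μ.real A * (Real.exp r - 1) := by
  have h : (fun ω => Real.exp (r * A.indicator (fun _ => (1 : ℝ)) ω)) =
      fun ω => 1 + A.indicator (fun _ => Real.exp r - 1) ω := by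
    ext ω
    by_cases hω : ω ∈ A <;> simp [hω]
  rw [mgf, h, integral_add (integrable_const _) ((integrable_const _).indicator hA),
    integral_indicator_const _ hA]
  simp

open Classical in
/-- A multiplicative Chernoff bound for the lower tail of a sum of independent indicators. -/
lemma measureReal_card_filter_le {A : ι → Set Ω} (hA : ∀ i, MeasurableSet (A i))
    (hind : iIndepSet A μ) (s : Finset ι) {x : ℝ} (hx : x ≤ ∑ i ∈ s, μ.real (A i)) :
    μ.real {ω | ((s.filter fun i => ω ∈ A i).card : ℝ) ≤ x / 4} ≤ Real.exp (-(x / 4)) := by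
  set X : ι → Ω → ℝ := fun i => (A i).indicator fun _ => 1
  have hXm : ∀ i, Measurable (X i) := fun i => measurable_const.indicator (hA i)
  have hcard : ∀ ω, ((s.filter fun i => ω ∈ A i).card : ℝ) = (∑ i ∈ s, X i) ω := fun ω => by
    simp [X, Set.indicator_apply]
  have hbd : ∀ ω, (∑ i ∈ s, X i) ω ∈ Set.Icc (0 : ℝ) s.card := fun ω => by
    rw [← hcard]
    exact ⟨Nat.cast_nonneg _, Nat.cast_le.2 (Finset.card_filter_le _ _)⟩
  have hint : Integrable (fun ω => Real.exp (-1 * (∑ i ∈ s, X i) ω)) μ :=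
    integrable_exp_mul_of_mem_Icc (Finset.aemeasurable_sum s fun i _ => (hXm i).aemeasurable)
      (Filter.Eventually.of_forall hbd)
  have h := measure_le_le_exp_mul_mgf (μ := μ) (x / 4) (by norm_num : (-1 : ℝ) ≤ 0) hint
  -- At parameter `-1`, `e⁻¹ ≤ 1/2` gives each factor at most `exp (-μ(A i) / 2)`; the prefactor
  -- `exp (x / 4)` leaves `exp (-(x / 4))`.
  have hmgf : mgf (∑ i ∈ s, X i) μ (-1) ≤ Real.exp (-(x / 2)) := by
    rw [hind.iIndepFun_indicator.mgf_sum hXm]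
    have he : Real.exp (-1) ≤ 1 / 2 := by
      have := Real.exp_one_gt_d9
      rw [Real.exp_neg, inv_eq_one_div]
      exact one_div_le_one_div_of_le (by norm_num) (by linarith)
    calc ∏ i ∈ s, mgf (X i) μ (-1) ≤ ∏ i ∈ s, Real.exp (-(μ.real (A i) / 2)) := by
          refine Finset.prod_le_prod (fun _ _ => mgf_nonneg) fun i _ => ?_
          rw [mgf_indicator_one (hA i)]
          have h1 := Real.add_one_le_exp (-(μ.real (A i) / 2))
          have h2 : μ.real (A i) * (Real.exp (-1) - 1) ≤ μ.real (A i) * (1 / 2 - 1) := by gcongr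
          linarith
      _ = Real.exp (-((∑ i ∈ s, μ.real (A i)) / 2)) := by
          rw [← Real.exp_sum, Finset.sum_neg_distrib, Finset.sum_div]
      _ ≤ _ := by gcongr
  simp_rw [hcard]
  calc _ ≤ _ := h
    _ ≤ Real.exp (-(-1) * (x / 4)) * Real.exp (-(x / 2)) := by gcongr
    _ = _ := by rw [← Real.exp_add]; ring_nf

/-- Hoeffding's inequality for linear forms in independent centred indicators. -/
lemma measureReal_sum_indicator_ge_le [Fintype ι] {A : ι → Set Ω} (hA : ∀ i, MeasurableSet (A i))
    (hind : iIndepSet A μ) {c : ι → ℝ} {V : ℝ} (hV0 : 0 < V) (hV : ∑ i, c i ^ 2 ≤ V)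
    {s : ℝ} (hs : 0 ≤ s) :
    μ.real {ω | s ≤ ∑ i, c i * ((A i).indicator (fun _ => (1 : ℝ)) ω - μ.real (A i))} ≤
      Real.exp (-(2 * s ^ 2 / V)) := by
  set X : ι → Ω → ℝ := fun i ω => c i * ((A i).indicator (fun _ => (1 : ℝ)) ω - μ.real (A i))
  have hXind : iIndepFun X μ :=
    hind.iIndepFun_indicator.comp (fun i x => c i * (x - μ.real (A i))) fun i => by fun_prop
  have hsub : ∀ i ∈ Finset.univ, HasSubgaussianMGF (X i)
      (⟨c i ^ 2, sq_nonneg _⟩ * (‖(1 : ℝ) - 0‖₊ / 2) ^ 2) μ := fun i _ => by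
    have h := hasSubgaussianMGF_of_mem_Icc (μ := μ) (a := 0) (b := 1)
      (X := (A i).indicator fun _ => (1 : ℝ)) (measurable_const.indicator (hA i)).aemeasurable
      (Filter.Eventually.of_forall fun ω => by
        by_cases hω : ω ∈ A i <;> simp [hω])
    rw [integral_indicator_const _ (hA i), smul_eq_mul, mul_one] at h
    exact h.const_mul (c i)
  have h := HasSubgaussianMGF.sum_of_iIndepFun hXind hsub
  have hc : ((∑ i, (⟨c i ^ 2, sq_nonneg _⟩ * (‖(1 : ℝ) - 0‖₊ / 2) ^ 2) : NNReal) : ℝ) ≤ V / 4 := by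
    rw [NNReal.coe_sum]
    have : ∀ i, ((⟨c i ^ 2, sq_nonneg _⟩ * (‖(1 : ℝ) - 0‖₊ / 2) ^ 2 : NNReal) : ℝ) =
        c i ^ 2 / 4 := fun i => by
      change c i ^ 2 * (((‖(1 : ℝ) - 0‖₊ / 2) ^ 2 : NNReal) : ℝ) = _
      simp
      ring
    simp_rw [this]
    rw [← Finset.sum_div]
    gcongr
  have h' : HasSubgaussianMGF (fun ω => ∑ i, X i ω) (⟨V / 4, by positivity⟩ : NNReal) μ :=
    ⟨h.integrable_exp_mul, fun r => (h.mgf_le r).trans (by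
      gcongr
      exact hc)⟩
  refine (h'.measure_ge_le hs).trans (le_of_eq ?_)
  congr 1
  change -s ^ 2 / (2 * (V / 4)) = _
  field_simp
  ring

/-- The σ-algebra is explicit because measurability is needed for the one generated by the outcomes
alone, not just the ambient one. -/
lemma measurableSet_sum_indicator_ge {Ω : Type*} {m : MeasurableSpace Ω} [Fintype ι]
    {A : ι → Set Ω} (hA : ∀ i, MeasurableSet[m] (A i)) (c d : ι → ℝ) (s : ℝ) :
    MeasurableSet[m] {ω | s ≤ ∑ i, c i * ((A i).indicator (fun _ => (1 : ℝ)) ω - d i)} := by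
  refine measurableSet_le measurable_const (Finset.measurable_sum _ fun i _ => ?_)
  exact ((measurable_const.indicator (hA i)).sub_const _).const_mul _

/-- Conditioning on a discrete variable that is independent of the events considered. -/
lemma measureReal_mem_and_le_of_indep {Ω α : Type*} [Fintype α]
    {m₁ m₂ m₀ : MeasurableSpace Ω} {μ : Measure Ω} [IsProbabilityMeasure μ]
    (hm₁ : m₁ ≤ m₀) (hind : Indep m₁ m₂ μ) {X : Ω → α}
    (hX : ∀ a, MeasurableSet[m₁] (X ⁻¹' {a})) (S : Set α) {B : α → Set Ω} {ε : ℝ} (hε : 0 ≤ ε)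
    (hB : ∀ a ∈ S, MeasurableSet[m₂] (B a)) (hBε : ∀ a ∈ S, μ.real (B a) ≤ ε) :
    μ.real {ω | X ω ∈ S ∧ ω ∈ B (X ω)} ≤ ε := by
  classical
  have hsub : {ω | X ω ∈ S ∧ ω ∈ B (X ω)} ⊆
      ⋃ a ∈ Finset.univ.filter (· ∈ S), X ⁻¹' {a} ∩ B a := by
    rintro ω ⟨h1, h2⟩
    simp only [Set.mem_iUnion]
    exact ⟨X ω, by simpa using h1, rfl, h2⟩
  calc _ ≤ μ.real (⋃ a ∈ Finset.univ.filter (· ∈ S), X ⁻¹' {a} ∩ B a) := measureReal_mono hsub (measure_ne_top _ _)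
    _ ≤ ∑ a ∈ Finset.univ.filter (· ∈ S), μ.real (X ⁻¹' {a} ∩ B a) :=
        measureReal_biUnion_finset_le _ _
    _ ≤ ∑ a ∈ Finset.univ.filter (· ∈ S), μ.real (X ⁻¹' {a}) * ε := by
        refine Finset.sum_le_sum fun a ha => ?_
        have ha' : a ∈ S := by simpa using ha
        have := (Indep_iff m₁ m₂ μ).1 hind _ _ (hX a) (hB a ha')
        rw [measureReal_def, this, ENNReal.toReal_mul]
        exact mul_le_mul_of_nonneg_left (hBε a ha') measureReal_nonneg
    _ = μ.real (X ⁻¹' (Finset.univ.filter (· ∈ S) : Finset α)) * ε := by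
        rw [← Finset.sum_mul, sum_measureReal_preimage_singleton _ fun a _ => hm₁ _ (hX a)]
    _ ≤ 1 * ε := by gcongr; exact measureReal_le_one
    _ = ε := one_mul ε

end Concentration

/-! ### Sums over pairs -/

section Pairs

variable {n : ℕ}

lemma sum_pair (f : Fin n → Fin n → ℝ) :
    ∑ q : Pair n, f q.1.1 q.1.2 = ∑ i, ∑ j, if i < j then f i j else 0 := by
  rw [← Fintype.sum_prod_type' fun i j => if i < j then f i j else 0, ← Finset.sum_filter]
  exact (Finset.sum_subtype _ (by simp) fun q : Fin n × Fin n => f q.1 q.2).symm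

lemma sum_sum_eq_two_mul_sum_pair {f : Fin n → Fin n → ℝ} (hsymm : ∀ i j, f i j = f j i)
    (hdiag : ∀ i, f i i = 0) : ∑ i, ∑ j, f i j = 2 * ∑ q : Pair n, f q.1.1 q.1.2 := by
  have h : ∀ i j, f i j = (if i < j then f i j else 0) + if j < i then f j i else 0 := by
    intro i j
    rcases lt_trichotomy i j with hij | rfl | hij
    · simp [hij, hij.not_gt]
    · simp [hdiag]
    · simp [hij, hij.not_gt, hsymm i j]
  calc ∑ i, ∑ j, f i j = ∑ i, ∑ j, ((if i < j then f i j else 0) + if j < i then f j i else 0) :=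
        Finset.sum_congr rfl fun i _ => Finset.sum_congr rfl fun j _ => h i j
    _ = _ := by
        simp_rw [Finset.sum_add_distrib]
        rw [Finset.sum_comm (f := fun i j => if j < i then f j i else 0), ← sum_pair]
        ring

/-- The entries `(i, j)` and `(j, i)` come from the same comparisons; grouping them by unordered
pair leaves independent terms. -/
lemma bilin_eq_sum_pair {E : Fin n → Fin n → ℝ} (hE : ∀ i j, E i j = -E j i) (u v : Fin n → ℝ) :
    ∑ i, ∑ j, u i * E i j * v j =
      ∑ q : Pair n, (u q.1.1 * v q.1.2 - u q.1.2 * v q.1.1) * E q.1.1 q.1.2 := by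
  have h := sum_sum_eq_two_mul_sum_pair (f := fun i j => (u i * v j - u j * v i) * E i j)
    (fun i j => by rw [hE i j]; ring) (fun i => by ring)
  have h2 : ∑ i, ∑ j, (u i * v j - u j * v i) * E i j =
      ∑ i, ∑ j, u i * E i j * v j + ∑ i, ∑ j, u i * E i j * v j := by
    have h3 : ∑ i, ∑ j, u i * E i j * v j = ∑ i, ∑ j, u j * E j i * v i := Finset.sum_comm
    nth_rewrite 2 [h3]
    simp_rw [← Finset.sum_add_distrib]
    refine Finset.sum_congr rfl fun i _ => Finset.sum_congr rfl fun j _ => ?_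
    rw [hE j i]
    ring
  linarith

/-- Lagrange's identity, dropping the square of the inner product. -/
lemma sum_pair_sq_le (u v : Fin n → ℝ) :
    ∑ q : Pair n, (u q.1.1 * v q.1.2 - u q.1.2 * v q.1.1) ^ 2 ≤ l2norm u ^ 2 * l2norm v ^ 2 := by
  have h := sum_sum_eq_two_mul_sum_pair (f := fun i j => (u i * v j - u j * v i) ^ 2)
    (fun i j => by ring) (fun i => by ring)
  have h2 : ∑ i, ∑ j, (u i * v j - u j * v i) ^ 2 =
      2 * ((∑ i, u i ^ 2) * ∑ j, v j ^ 2) - 2 * (∑ i, u i * v i) ^ 2 := by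
    have e : ∀ i j, (u i * v j - u j * v i) ^ 2 =
        u i ^ 2 * v j ^ 2 + v i ^ 2 * u j ^ 2 - 2 * ((u i * v i) * (u j * v j)) := by
      intros; ring
    simp_rw [e, Finset.sum_sub_distrib, Finset.sum_add_distrib, ← Finset.mul_sum, ← Finset.sum_mul]
    ring
  rw [l2norm_sq, l2norm_sq]
  linarith [sq_nonneg (∑ i, u i * v i)]

end Pairs

/-! ### The comparison times -/

section Grid

lemma gridPoint_mem_Icc {T : ℕ} (k : Fin (T + 1)) : gridPoint T k ∈ Set.Icc (0 : ℝ) 1 := by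
  have : (k : ℝ) ≤ T := Nat.cast_le.2 (Nat.lt_succ_iff.1 k.2)
  exact ⟨by unfold gridPoint; positivity, div_le_one_of_le₀ this (Nat.cast_nonneg T)⟩

/-- Clipped to `[0, T]`, the window around `t * T` still has length at least `δ`, even at an
endpoint, because `δ ≤ T`. It contains at least `δ - 1 ≥ δ / 2` integers. -/
lemma half_le_card_nbhd {T : ℕ} (hT : 1 ≤ T) {δ t : ℝ} (ht : t ∈ Set.Icc (0 : ℝ) 1) (h2 : 2 ≤ δ)
    (hδ : δ ≤ T) : δ / 2 ≤ (nbhd T δ t).card := by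
  have hT0 : (0 : ℝ) < T := by exact_mod_cast hT
  set a := max 0 (t * T - δ) with ha
  set c := min (T : ℝ) (t * T + δ) with hc
  have h0 : 0 ≤ t * T := mul_nonneg ht.1 hT0.le
  have h1 : t * T ≤ T := mul_le_of_le_one_left hT0.le ht.2
  have hca : δ ≤ c - a := by
    rcases max_cases 0 (t * T - δ) with ⟨e, -⟩ | ⟨e, -⟩ <;>
      rcases min_cases (T : ℝ) (t * T + δ) with ⟨e', -⟩ | ⟨e', -⟩ <;> rw [ha, hc, e, e'] <;> linarith
  have ha0 : 0 ≤ a := le_max_left _ _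
  have hc0 : 0 ≤ c := by linarith
  have hcard : (Finset.Icc ⌈a⌉₊ ⌊c⌋₊).card ≤ (nbhd T δ t).card := by
    refine Finset.card_le_card_of_injOn (fun k => Fin.ofNat (T + 1) k) ?_ ?_
    · intro k hk
      obtain ⟨hk1, hk2⟩ := Finset.mem_Icc.1 hk
      have hk1' := Nat.ceil_le.1 hk1
      have hk2' := (Nat.le_floor_iff hc0).1 hk2
      have hkT : k < T + 1 := by
        have : (k : ℝ) ≤ T := hk2'.trans (min_le_left _ _)
        exact Nat.lt_succ_iff.2 (Nat.cast_le.1 this)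
      have b1 : t * T - δ ≤ k := (le_max_right _ _).trans hk1'
      have b2 : (k : ℝ) ≤ t * T + δ := hk2'.trans (min_le_right _ _)
      rw [Finset.mem_coe, nbhd, Finset.mem_filter]
      refine ⟨Finset.mem_univ _, ?_⟩
      simp only [gridPoint, Fin.val_ofNat, Nat.mod_eq_of_lt hkT]
      have e : t - (k : ℝ) / T = (t * T - k) / T := by field_simp
      rw [e, abs_div, abs_of_pos hT0]
      gcongr
      exact abs_le.2 ⟨by linarith, by linarith⟩
    · intro k hk l hl hkl
      have lt : ∀ k ∈ (Finset.Icc ⌈a⌉₊ ⌊c⌋₊ : Finset ℕ), k < T + 1 := fun k hk => by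
        have hk2' := (Nat.le_floor_iff hc0).1 (Finset.mem_Icc.1 hk).2
        have : (k : ℝ) ≤ T := hk2'.trans (min_le_left _ _)
        exact Nat.lt_succ_iff.2 (Nat.cast_le.1 this)
      have := congrArg Fin.val hkl
      simpa [Fin.val_ofNat, Nat.mod_eq_of_lt (lt k hk), Nat.mod_eq_of_lt (lt l hl)] using this
  have h3 : ⌈a⌉₊ ≤ ⌊c⌋₊ + 1 := by
    have h3 := Nat.ceil_lt_add_one ha0
    have h4 := Nat.lt_floor_add_one c
    have : (⌈a⌉₊ : ℝ) < ((⌊c⌋₊ + 1 : ℕ) : ℝ) := by push_cast; linarith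
    exact (Nat.cast_lt.1 this).le
  have h4 : δ - 1 ≤ ((Finset.Icc ⌈a⌉₊ ⌊c⌋₊).card : ℝ) := by
    rw [Nat.card_Icc, Nat.cast_sub h3]
    push_cast
    linarith [Nat.ceil_lt_add_one ha0, Nat.lt_floor_add_one c]
  have h5 : ((Finset.Icc ⌈a⌉₊ ⌊c⌋₊).card : ℝ) ≤ (nbhd T δ t).card := Nat.cast_le.2 hcard
  linarith

lemma pMin_le {T : ℕ} (p : Fin (T + 1) → ℝ) (k : Fin (T + 1)) : pMin p ≤ p k :=
  ciInf_le (Finite.bddBelow_range p) k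

lemma pMin_mul_card_le {T : ℕ} (p : Fin (T + 1) → ℝ) (s : Finset (Fin (T + 1))) :
    pMin p * s.card ≤ ∑ k ∈ s, p k := by
  have := Finset.card_nsmul_le_sum s p (pMin p) fun k _ => pMin_le p k
  rwa [nsmul_eq_mul, mul_comm] at this

/-- By `1 - p ≤ exp (-p)`. This makes the normalisation `3 n p_δ` at least `n`, which keeps the
diagonal of the transition matrix nonnegative. -/
lemma half_le_pUnion {T : ℕ} {p : Fin (T + 1) → ℝ} (hp : ∀ k, p k ≤ 1) {δ t : ℝ}
    (h : 1 ≤ ∑ k ∈ nbhd T δ t, p k) : 1 / 2 ≤ pUnion p δ t := by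
  have h1 : ∏ k ∈ nbhd T δ t, (1 - p k) ≤ ∏ k ∈ nbhd T δ t, Real.exp (-p k) :=
    Finset.prod_le_prod (fun k _ => sub_nonneg.2 (hp k)) fun k _ => by
      linarith [Real.add_one_le_exp (-p k)]
  rw [← Real.exp_sum, Finset.sum_neg_distrib] at h1
  have h2 : Real.exp (-∑ k ∈ nbhd T δ t, p k) ≤ Real.exp (-1) := Real.exp_le_exp.2 (by linarith)
  have h3 : Real.exp (-1) ≤ 1 / 2 := by
    have := Real.exp_one_gt_d9
    rw [Real.exp_neg, inv_eq_one_div]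
    exact one_div_le_one_div_of_le (by norm_num) (by linarith)
  unfold pUnion
  linarith

end Grid

/-! ### The noise matrix -/

section Noise

variable {n T L : ℕ}

/-- The deviation of the averaged win frequencies from their conditional means. -/
noncomputable def noise (w : ℝ → Fin n → ℝ) (δ t : ℝ) (g : Fin (T + 1) → SimpleGraph (Fin n))
    (z : Fin (T + 1) → Fin n → Fin n → Fin L → Bool) (i j : Fin n) : ℝ :=
  (1 / ((pairTimes δ t g i j).card : ℝ)) *
    ∑ k ∈ pairTimes δ t g i j, (winFreq z k i j - winProb w (gridPoint T k) i j)

lemma pairTimes_comm (δ t : ℝ) (g : Fin (T + 1) → SimpleGraph (Fin n)) (i j : Fin n) :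
    pairTimes δ t g i j = pairTimes δ t g j i := by
  ext k
  simp only [pairTimes, Finset.mem_filter, (g k).adj_comm i j]

lemma pairTimes_self (δ t : ℝ) (g : Fin (T + 1) → SimpleGraph (Fin n)) (i : Fin n) :
    pairTimes δ t g i i = ∅ := by
  simp [pairTimes]

lemma winFreq_mem_Icc (z : Fin (T + 1) → Fin n → Fin n → Fin L → Bool) (k : Fin (T + 1))
    (i j : Fin n) : winFreq z k i j ∈ Set.Icc (0 : ℝ) 1 := by
  have h0 : (0 : ℝ) ≤ ∑ l : Fin L, if z k i j l = true then 1 else 0 :=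
    Finset.sum_nonneg fun l _ => by split_ifs <;> norm_num
  have h1 : (∑ l : Fin L, if z k i j l = true then (1 : ℝ) else 0) ≤ L := by
    simpa using Finset.sum_le_card_nsmul Finset.univ
      (fun l : Fin L => if z k i j l = true then (1 : ℝ) else 0) 1
      fun l _ => by split_ifs <;> norm_num
  unfold winFreq
  refine ⟨by positivity, ?_⟩
  rw [one_div_mul_eq_div]
  exact div_le_one_of_le₀ h1 (Nat.cast_nonneg L)

lemma winFreq_swap (hL : 1 ≤ L) {z : Fin (T + 1) → Fin n → Fin n → Fin L → Bool}
    (hz : ∀ k i j l, i ≠ j → z k j i l = !(z k i j l)) (k : Fin (T + 1)) {i j : Fin n}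
    (hij : i ≠ j) : winFreq z k j i = 1 - winFreq z k i j := by
  have hL0 : (L : ℝ) ≠ 0 := by positivity
  have : ∀ l, (if z k j i l = true then (1 : ℝ) else 0) =
      1 - if z k i j l = true then (1 : ℝ) else 0 := fun l => by
    rw [hz k i j l hij]
    cases z k i j l <;> simp
  unfold winFreq
  simp_rw [this, Finset.sum_sub_distrib]
  simp only [Finset.sum_const, Finset.card_univ, Fintype.card_fin, nsmul_eq_mul, mul_one]
  field_simp

lemma winProb_swap {w : ℝ → Fin n → ℝ} {t : ℝ} (hw : ∀ i, 0 < w t i) (i j : Fin n) :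
    winProb w t j i = 1 - winProb w t i j := by
  have := (add_pos (hw i) (hw j)).ne'
  unfold winProb
  rw [add_comm (w t j)]
  field_simp
  ring

lemma noise_antisymm (hL : 1 ≤ L) {w : ℝ → Fin n → ℝ}
    (hw : ∀ t ∈ Set.Icc (0 : ℝ) 1, ∀ i, 0 < w t i)
    {z : Fin (T + 1) → Fin n → Fin n → Fin L → Bool}
    (hz : ∀ k i j l, i ≠ j → z k j i l = !(z k i j l)) (δ t : ℝ)
    (g : Fin (T + 1) → SimpleGraph (Fin n)) (i j : Fin n) :
    noise w δ t g z i j = -noise w δ t g z j i := by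
  rcases eq_or_ne i j with rfl | hij
  · simp [noise, pairTimes_self]
  unfold noise
  rw [pairTimes_comm δ t g j i, ← mul_neg, ← Finset.sum_neg_distrib]
  congr 1
  refine Finset.sum_congr rfl fun k _ => ?_
  rw [winFreq_swap hL hz k hij, winProb_swap (hw _ (gridPoint_mem_Icc k)) i j]
  ring

open Classical in
/-- The coefficients of the bilinear form of the noise in the individual comparisons. -/
noncomputable def noiseCoeff (L : ℕ) (δ t : ℝ) (g : Fin (T + 1) → SimpleGraph (Fin n))
    (u v : Fin n → ℝ) (a : Fin (T + 1) × Pair n × Fin L) : ℝ :=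
  (u a.2.1.1.1 * v a.2.1.1.2 - u a.2.1.1.2 * v a.2.1.1.1) *
    if a.1 ∈ pairTimes δ t g a.2.1.1.1 a.2.1.1.2 then
      1 / ((pairTimes δ t g a.2.1.1.1 a.2.1.1.2).card * L : ℝ) else 0

/-- A pair compared at `N` times contributes `N * L` coefficients of weight `1 / (N L)`, so their
squares sum to `1 / (N L) ≤ 1 / (m L)`. -/
lemma sum_noiseCoeff_sq_le (hL : 1 ≤ L) {δ t : ℝ} {g : Fin (T + 1) → SimpleGraph (Fin n)} {m : ℝ}
    (hm : 0 < m) (hg : ∀ i j, i ≠ j → m ≤ (pairTimes δ t g i j).card) (u v : Fin n → ℝ) :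
    ∑ a, noiseCoeff L δ t g u v a ^ 2 ≤ l2norm u ^ 2 * l2norm v ^ 2 / (m * L) := by
  classical
  have hL0 : (0 : ℝ) < L := by exact_mod_cast hL
  rw [Fintype.sum_prod_type_right]
  rw [Fintype.sum_prod_type]
  calc _ ≤ ∑ q : Pair n, (u q.1.1 * v q.1.2 - u q.1.2 * v q.1.1) ^ 2 * (1 / (m * L)) := by
        refine Finset.sum_le_sum fun q _ => ?_
        have hq := hg q.1.1 q.1.2 q.2.ne
        set N := pairTimes δ t g q.1.1 q.1.2 with hN
        have hN0 : (0 : ℝ) < N.card := hm.trans_le hq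
        have e : ∑ l : Fin L, ∑ k, noiseCoeff L δ t g u v (k, q, l) ^ 2 =
            (u q.1.1 * v q.1.2 - u q.1.2 * v q.1.1) ^ 2 * (1 / (N.card * L)) := by
          simp only [noiseCoeff, ← hN, mul_pow, ite_pow, ← Finset.mul_sum]
          simp
          left
          field_simp
        rw [e]
        gcongr
    _ = (∑ q : Pair n, (u q.1.1 * v q.1.2 - u q.1.2 * v q.1.1) ^ 2) * (1 / (m * L)) := by
        rw [Finset.sum_mul]
    _ ≤ l2norm u ^ 2 * l2norm v ^ 2 * (1 / (m * L)) := by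
        gcongr
        exact sum_pair_sq_le u v
    _ = _ := by ring

end Noise

/-! ### The model -/

/-- The σ-algebra generated by the comparison outcomes. -/
abbrev outcomeSigma {n T L : ℕ} {Ω : Type*} (G : Ω → Fin (T + 1) → SimpleGraph (Fin n))
    (y : Ω → Fin (T + 1) → Fin n → Fin n → Fin L → Bool) : MeasurableSpace Ω :=
  MeasurableSpace.generateFrom {s | ∃ a ∈ Set.range Sum.inr, elementaryEvent G y a = s}

/-- The σ-algebra generated by the comparison graphs. -/
abbrev graphSigma {n T L : ℕ} {Ω : Type*} (G : Ω → Fin (T + 1) → SimpleGraph (Fin n))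
    (y : Ω → Fin (T + 1) → Fin n → Fin n → Fin L → Bool) : MeasurableSpace Ω :=
  MeasurableSpace.generateFrom {s | ∃ a ∈ Set.range Sum.inl, elementaryEvent G y a = s}

lemma measurableSet_preimage_graph {n T L : ℕ} {Ω : Type*}
    {G : Ω → Fin (T + 1) → SimpleGraph (Fin n)}
    {y : Ω → Fin (T + 1) → Fin n → Fin n → Fin L → Bool} (g : Fin (T + 1) → SimpleGraph (Fin n)) :
    MeasurableSet[graphSigma G y] (G ⁻¹' {g}) := by
  classical
  have : G ⁻¹' {g} = ⋂ (k : Fin (T + 1)), ⋂ (q : Pair n),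
      if (g k).Adj q.1.1 q.1.2 then elementaryEvent G y (Sum.inl (k, q))
        else (elementaryEvent G y (Sum.inl (k, q)))ᶜ := by
    ext ω
    simp only [Set.mem_preimage, Set.mem_singleton_iff, Set.mem_iInter]
    constructor
    · rintro rfl k q
      split_ifs with h
      exacts [h, h]
    · intro h
      have key : ∀ k (i j : Fin n), i < j → ((G ω k).Adj i j ↔ (g k).Adj i j) := fun k i j hij => by
        have := h k ⟨(i, j), hij⟩
        split_ifs at this with h'
        · exact iff_of_true this h'
        · exact iff_of_false this h'
      ext k i j
      rcases lt_trichotomy i j with hij | rfl | hij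
      · exact key k i j hij
      · simp
      · rw [SimpleGraph.adj_comm, (g k).adj_comm]
        exact key k j i hij
  rw [this]
  refine MeasurableSet.iInter fun k => MeasurableSet.iInter fun q => ?_
  have hm : MeasurableSet[graphSigma G y] (elementaryEvent G y (Sum.inl (k, q))) :=
    MeasurableSpace.measurableSet_generateFrom ⟨_, ⟨_, rfl⟩, rfl⟩
  split_ifs
  exacts [hm, hm.compl]

section Model

variable {n T L : ℕ} {Ω : Type*} [MeasurableSpace Ω] {μ : Measure Ω}
  {w : ℝ → Fin n → ℝ} {p : Fin (T + 1) → ℝ} {G : Ω → Fin (T + 1) → SimpleGraph (Fin n)}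
  {y : Ω → Fin (T + 1) → Fin n → Fin n → Fin L → Bool}

/-- The `l`-th comparison of the pair `q` at time `k` is won by the larger item. -/
abbrev outcomeEvent (G : Ω → Fin (T + 1) → SimpleGraph (Fin n))
    (y : Ω → Fin (T + 1) → Fin n → Fin n → Fin L → Bool)
    (a : Fin (T + 1) × Pair n × Fin L) : Set Ω :=
  elementaryEvent G y (Sum.inr a)

lemma measureReal_outcomeEvent (hM : IsDynamicBTL μ w p G y)
    (hw : ∀ t ∈ Set.Icc (0 : ℝ) 1, ∀ i, 0 < w t i) (a : Fin (T + 1) × Pair n × Fin L) :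
    μ.real (outcomeEvent G y a) = winProb w (gridPoint T a.1) a.2.1.1.1 a.2.1.1.2 := by
  obtain ⟨k, q, l⟩ := a
  have h := hM.win_prob k q.1.1 q.1.2 l q.2.ne
  have h0 := fun i => hw _ (gridPoint_mem_Icc k) i
  rw [measureReal_def]
  change (μ {ω | y ω k q.1.1 q.1.2 l = true}).toReal = _
  rw [h, ENNReal.toReal_ofReal]
  exact (div_pos (h0 _) (add_pos (h0 _) (h0 _))).le

/-- The graph sequence `g` is fixed here, so the coefficients are deterministic; substituting `G ω`
is left to the conditioning step. -/
lemma bilin_noise_eq (hL : 1 ≤ L) (hM : IsDynamicBTL μ w p G y)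
    (hw : ∀ t ∈ Set.Icc (0 : ℝ) 1, ∀ i, 0 < w t i) (δ t : ℝ)
    (g : Fin (T + 1) → SimpleGraph (Fin n)) (u v : Fin n → ℝ) (ω : Ω) :
    ∑ i, ∑ j, u i * noise w δ t g (y ω) i j * v j = ∑ a, noiseCoeff L δ t g u v a *
      ((outcomeEvent G y a).indicator (fun _ => (1 : ℝ)) ω - μ.real (outcomeEvent G y a)) := by
  classical
  have hL0 : (L : ℝ) ≠ 0 := by positivity
  rw [bilin_eq_sum_pair (noise_antisymm hL hw (hM.win_swap ω) δ t g), Fintype.sum_prod_type_right]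
  rw [Fintype.sum_prod_type]
  refine Finset.sum_congr rfl fun q _ => ?_
  simp_rw [measureReal_outcomeEvent hM hw]
  rw [Finset.sum_comm]
  simp only [noiseCoeff, mul_assoc, ← Finset.mul_sum]
  congr 1
  simp only [ite_mul, zero_mul]
  rw [noise, Finset.mul_sum]
  have e : ∀ k, 1 / (((pairTimes δ t g q.1.1 q.1.2).card : ℝ) * L) *
      ∑ l : Fin L, ((outcomeEvent G y (k, q, l)).indicator (fun _ => (1 : ℝ)) ω -
          winProb w (gridPoint T k) q.1.1 q.1.2) =
      1 / ((pairTimes δ t g q.1.1 q.1.2).card : ℝ) *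
        (winFreq (y ω) k q.1.1 q.1.2 - winProb w (gridPoint T k) q.1.1 q.1.2) := by
    intro k
    have : ∀ l, (outcomeEvent G y (k, q, l)).indicator (fun _ => (1 : ℝ)) ω =
        if y ω k q.1.1 q.1.2 l = true then 1 else 0 := fun l => by
      have hmem : ω ∈ outcomeEvent G y (k, q, l) ↔ y ω k q.1.1 q.1.2 l = true := Iff.rfl
      simp only [Set.indicator_apply, hmem]
    rw [Finset.sum_sub_distrib]
    simp_rw [this]
    simp only [winFreq, Finset.sum_const, Finset.card_univ, Fintype.card_fin, nsmul_eq_mul]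
    generalize (∑ l : Fin L, if y ω k q.1.1 q.1.2 l = true then (1 : ℝ) else 0) = S
    rcases eq_or_ne ((pairTimes δ t g q.1.1 q.1.2).card : ℝ) 0 with h0 | h0
    · simp [h0]
    · field_simp
  simp_rw [e, Finset.sum_ite_mem, Finset.univ_inter]

lemma measureReal_bilin_noise_ge_le [IsProbabilityMeasure μ] (hL : 1 ≤ L) (hM : IsDynamicBTL μ w p G y)
    (hw : ∀ t ∈ Set.Icc (0 : ℝ) 1, ∀ i, 0 < w t i) {δ t : ℝ}
    {g : Fin (T + 1) → SimpleGraph (Fin n)} {m : ℝ} (hm : 0 < m)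
    (hg : ∀ i j, i ≠ j → m ≤ (pairTimes δ t g i j).card) {u v : Fin n → ℝ} {V : ℝ} (hV : 0 < V)
    (huv : l2norm u ^ 2 * l2norm v ^ 2 ≤ V) {s : ℝ} (hs : 0 ≤ s) :
    μ.real {ω | s ≤ ∑ i, ∑ j, u i * noise w δ t g (y ω) i j * v j} ≤
      Real.exp (-(2 * s ^ 2 * (m * L) / V)) := by
  have hL0 : (0 : ℝ) < L := by exact_mod_cast hL
  simp_rw [bilin_noise_eq hL hM hw]
  have hind : iIndepSet (outcomeEvent G y) μ := hM.indep.precomp Sum.inr_injective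
  refine (measureReal_sum_indicator_ge_le (fun a => hM.measurable _) hind
    (V := V / (m * L)) (by positivity)
    ((sum_noiseCoeff_sq_le hL hm hg u v).trans (by gcongr)) hs).trans (le_of_eq ?_)
  congr 2
  field_simp

end Model

/-! ### The high-probability event -/

section Event

variable {n T L : ℕ}

/-- Every pair is compared at least `m` times in the neighbourhood, and the noise matrix has operator
norm at most `s` and row sums at most `s'`. -/
structure IsConcentrated (w : ℝ → Fin n → ℝ) (δ t m s s' : ℝ)
    (g : Fin (T + 1) → SimpleGraph (Fin n))
    (z : Fin (T + 1) → Fin n → Fin n → Fin L → Bool) : Prop where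
  le_card : ∀ i j, i ≠ j → m ≤ (pairTimes δ t g i j).card
  opNorm_le : ∀ v, l2norm (v ᵥ* Matrix.of (noise w δ t g z)) ≤ s * l2norm v
  abs_row_le : ∀ i, |∑ j, noise w δ t g z i j| ≤ s'

variable {Ω : Type*} [MeasurableSpace Ω] {μ : Measure Ω} [IsProbabilityMeasure μ]
  {w : ℝ → Fin n → ℝ} {p : Fin (T + 1) → ℝ} {G : Ω → Fin (T + 1) → SimpleGraph (Fin n)}
  {y : Ω → Fin (T + 1) → Fin n → Fin n → Fin L → Bool}

lemma measureReal_card_pairTimes_le (hM : IsDynamicBTL μ w p G y) (hp : ∀ k, 0 ≤ p k) {δ t x : ℝ}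
    (hx : x ≤ ∑ k ∈ nbhd T δ t, p k) (q : Pair n) :
    μ.real {ω | ((pairTimes δ t (G ω) q.1.1 q.1.2).card : ℝ) ≤ x / 4} ≤ Real.exp (-(x / 4)) := by
  classical
  have hind : iIndepSet (fun k : Fin (T + 1) => elementaryEvent G y (Sum.inl (k, q))) μ :=
    hM.indep.precomp (g := fun k : Fin (T + 1) => Sum.inl (k, q)) fun k l hkl => by simpa using hkl
  have hprob : ∀ k, μ.real (elementaryEvent G y (Sum.inl (k, q))) = p k := fun k => by
    have h := hM.edge_prob k q.1.1 q.1.2 q.2.ne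
    rw [measureReal_def]
    change (μ {ω | (G ω k).Adj q.1.1 q.1.2}).toReal = _
    rw [h, ENNReal.toReal_ofReal (hp k)]
  have h := measureReal_card_filter_le (fun k => hM.measurable _) hind (nbhd T δ t) (x := x)
    (by simpa only [hprob] using hx)
  exact h

/-- Three union bounds: over the pairs for the counts, over pairs of net points (`25 ^ n = (5 ^
n)²`) for the operator norm, and over rows with both signs for the row sums. The last two are
conditional on graphs with enough comparisons. -/
lemma measureReal_not_isConcentrated_le (hn : 0 < n) (hL : 1 ≤ L) (hM : IsDynamicBTL μ w p G y)
    (hw : ∀ t ∈ Set.Icc (0 : ℝ) 1, ∀ i, 0 < w t i) (hp : ∀ k, 0 ≤ p k) {δ t x s s' : ℝ}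
    (hx0 : 0 < x) (hx : x ≤ ∑ k ∈ nbhd T δ t, p k) (hs : 0 ≤ s) (hs' : 0 ≤ s') :
    μ.real {ω | ¬ IsConcentrated w δ t (x / 4) s s' (G ω) (y ω)} ≤
      n ^ 2 * Real.exp (-(x / 4)) + (25 ^ n * Real.exp (-(2 * s ^ 2 * (x / 4 * L) / 16)) +
        2 * n * Real.exp (-(2 * s' ^ 2 * (x / 4 * L) / n))) := by
  classical
  obtain ⟨N, hNcard, hN2, hNnet⟩ := exists_net n
  have hn0 : (0 : ℝ) < n := Nat.cast_pos.2 hn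
  set F : (Fin (T + 1) → SimpleGraph (Fin n)) → (Fin n → ℝ) → (Fin n → ℝ) → ℝ → Set Ω :=
    fun g u v r => {ω | r ≤ ∑ i, ∑ j, u i * noise w δ t g (y ω) i j * v j} with hF
  -- A signed row sum is the bilinear form at a signed basis vector and the all-ones vector.
  set e : Fin n → ℝ → Fin n → ℝ := fun i r => Pi.single i r
  set B : (Fin (T + 1) → SimpleGraph (Fin n)) → Set Ω := fun g =>
    (⋃ c ∈ N ×ˢ N, F g c.1 c.2 s) ∪
      ⋃ i ∈ (Finset.univ : Finset (Fin n)), (F g (e i 1) (fun _ => 1) s' ∪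
        F g (e i (-1)) (fun _ => 1) s') with hB
  set S : Set (Fin (T + 1) → SimpleGraph (Fin n)) :=
    {g | ∀ i j, i ≠ j → x / 4 ≤ (pairTimes δ t g i j).card} with hS
  have hFm : ∀ g u v r, MeasurableSet[outcomeSigma G y] (F g u v r) := fun g u v r => by
    simp only [hF, bilin_noise_eq hL hM hw]
    have hm : ∀ a, MeasurableSet[outcomeSigma G y] (outcomeEvent G y a) := fun a =>
      MeasurableSpace.measurableSet_generateFrom ⟨_, ⟨a, rfl⟩, rfl⟩
    exact measurableSet_sum_indicator_ge hm _ _ _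
  have hBm : ∀ g, MeasurableSet[outcomeSigma G y] (B g) := fun g =>
    (Finset.measurableSet_biUnion _ fun c _ => hFm _ _ _ _).union
      (Finset.measurableSet_biUnion _ fun i _ => (hFm _ _ _ _).union (hFm _ _ _ _))
  have he : ∀ i r, |r| = 1 → l2norm (e i r) ^ 2 * l2norm (fun _ : Fin n => (1 : ℝ)) ^ 2 ≤ n := by
    intro i r hr
    have h1 : l2norm (e i r) ^ 2 = 1 := by
      rw [l2norm_sq, Finset.sum_eq_single i (fun j _ hj => by simp [e, hj]) (by simp)]
      simp [e, ← sq_abs r, hr]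
    rw [h1, l2norm_sq]
    simp
  have hBle : ∀ g ∈ S, μ.real (B g) ≤ 25 ^ n * Real.exp (-(2 * s ^ 2 * (x / 4 * L) / 16)) +
        2 * n * Real.exp (-(2 * s' ^ 2 * (x / 4 * L) / n)) := fun g hg => by
    have hx4 : 0 < x / 4 := by positivity
    refine (measureReal_union_le _ _).trans (add_le_add ?_ ?_)
    · calc _ ≤ ∑ c ∈ N ×ˢ N, μ.real (F g c.1 c.2 s) := measureReal_biUnion_finset_le _ _
        _ ≤ ∑ c ∈ N ×ˢ N, Real.exp (-(2 * s ^ 2 * (x / 4 * L) / 16)) := by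
            refine Finset.sum_le_sum fun c hc => ?_
            obtain ⟨hc1, hc2⟩ := Finset.mem_product.1 hc
            refine measureReal_bilin_noise_ge_le hL hM hw hx4 hg (by norm_num) ?_ hs
            have h1 : l2norm c.1 ^ 2 ≤ 2 ^ 2 := pow_le_pow_left₀ (l2norm_nonneg _) (hN2 _ hc1) 2
            have h2 : l2norm c.2 ^ 2 ≤ 2 ^ 2 := pow_le_pow_left₀ (l2norm_nonneg _) (hN2 _ hc2) 2
            calc _ ≤ (2 : ℝ) ^ 2 * 2 ^ 2 := by gcongr
              _ = 16 := by norm_num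
        _ = ((N.card * N.card : ℕ) : ℝ) * Real.exp (-(2 * s ^ 2 * (x / 4 * L) / 16)) := by
            rw [Finset.sum_const, Finset.card_product, nsmul_eq_mul]
        _ ≤ _ := by
            gcongr
            have : N.card * N.card ≤ 5 ^ n * 5 ^ n := Nat.mul_le_mul hNcard hNcard
            rw [← mul_pow] at this
            exact_mod_cast this
    · calc _ ≤ ∑ i, μ.real (F g (e i 1) (fun _ => 1) s' ∪ F g (e i (-1)) (fun _ => 1) s') :=
            measureReal_biUnion_finset_le _ _
        _ ≤ ∑ _i : Fin n, 2 * Real.exp (-(2 * s' ^ 2 * (x / 4 * L) / n)) := by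
            refine Finset.sum_le_sum fun i _ => (measureReal_union_le _ _).trans ?_
            rw [two_mul]
            exact add_le_add
              (measureReal_bilin_noise_ge_le hL hM hw hx4 hg hn0 (he i 1 (by simp)) hs')
              (measureReal_bilin_noise_ge_le hL hM hw hx4 hg hn0 (he i (-1) (by simp)) hs')
        _ = _ := by
            rw [Finset.sum_const, Finset.card_univ, Fintype.card_fin, nsmul_eq_mul]
            ring
  have hgm : graphSigma G y ≤ ‹MeasurableSpace Ω› :=
    MeasurableSpace.generateFrom_le (by rintro _ ⟨a, -, rfl⟩; exact hM.measurable a)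
  have hindep : Indep (graphSigma G y) (outcomeSigma G y) μ :=
    hM.indep.indep_generateFrom_of_disjoint hM.measurable _ _
      (Set.isCompl_range_inl_range_inr.disjoint)
  have : Fintype (Fin (T + 1) → SimpleGraph (Fin n)) := Fintype.ofFinite _
  have hcond := measureReal_mem_and_le_of_indep hgm hindep measurableSet_preimage_graph S
    (by positivity) (fun g _ => hBm g) hBle
  have hsub : {ω | ¬ IsConcentrated w δ t (x / 4) s s' (G ω) (y ω)} ⊆
      (⋃ q ∈ (Finset.univ : Finset (Pair n)),
        {ω | ((pairTimes δ t (G ω) q.1.1 q.1.2).card : ℝ) ≤ x / 4}) ∪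
      {ω | G ω ∈ S ∧ ω ∈ B (G ω)} := by
    intro ω hω
    by_contra hcon
    simp only [Set.mem_union, not_or] at hcon
    obtain ⟨h1, h2⟩ := hcon
    have hcard : ∀ q : Pair n, x / 4 < ((pairTimes δ t (G ω) q.1.1 q.1.2).card : ℝ) := fun q => by
      by_contra hq
      exact h1 (Set.mem_biUnion (Finset.mem_coe.2 (Finset.mem_univ q)) (not_lt.1 hq))
    have hmS : G ω ∈ S := fun i j hij => by
      rcases lt_or_gt_of_ne hij with h | h
      · exact (hcard ⟨(i, j), h⟩).le
      · rw [pairTimes_comm]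
        exact (hcard ⟨(j, i), h⟩).le
    have hnB : ω ∉ B (G ω) := fun h => h2 ⟨hmS, h⟩
    simp only [hB, Set.mem_union, not_or, Set.mem_iUnion, not_exists] at hnB
    refine hω ⟨hmS, l2norm_vecMul_le_of_net hNnet hs fun u hu v hv => ?_, fun i => ?_⟩
    · exact (not_le.1 (hnB.1 (u, v) (Finset.mk_mem_product hu hv))).le
    · have hrow : ∀ r : ℝ, ∑ k, ∑ j, e i r k * noise w δ t (G ω) (y ω) k j * 1 =
          r * ∑ j, noise w δ t (G ω) (y ω) i j := fun r => by
        rw [Finset.sum_eq_single i (fun k _ hk => by simp [e, hk]) (by simp)]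
        simp [e, Finset.mul_sum]
      obtain ⟨r1, r2⟩ := hnB.2 i (Finset.mem_univ i)
      simp only [hF, Set.mem_ofPred_eq, not_le] at r1 r2
      rw [hrow] at r1 r2
      exact abs_le.2 ⟨by linarith, by linarith⟩
  calc _ ≤ _ := measureReal_mono hsub (measure_ne_top _ _)
    _ ≤ _ := measureReal_union_le _ _
    _ ≤ _ := by
      refine add_le_add ?_ hcond
      calc _ ≤ ∑ q : Pair n, μ.real {ω | ((pairTimes δ t (G ω) q.1.1 q.1.2).card : ℝ) ≤ x / 4} :=
            measureReal_biUnion_finset_le _ _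
        _ ≤ ∑ _q : Pair n, Real.exp (-(x / 4)) :=
            Finset.sum_le_sum fun q _ => measureReal_card_pairTimes_le hM hp hx q
        _ = (Fintype.card (Pair n) : ℝ) * Real.exp (-(x / 4)) := by
            rw [Finset.sum_const, Finset.card_univ, nsmul_eq_mul]
        _ ≤ _ := by
            gcongr
            have : Fintype.card (Pair n) ≤ n * n := by
              simpa using Fintype.card_subtype_le fun q : Fin n × Fin n => q.1 < q.2
            rw [sq]
            exact_mod_cast this

/-- With the natural choice of the thresholds, concentration fails with probability at most
`4 n ^ (-10)`. -/
lemma measureReal_not_isConcentrated_le_pow (hn : 0 < n) (hL : 1 ≤ L)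
    (hM : IsDynamicBTL μ w p G y) (hw : ∀ t ∈ Set.Icc (0 : ℝ) 1, ∀ i, 0 < w t i)
    (hp : ∀ k, 0 ≤ p k) {δ t m : ℝ} (hm0 : 0 < m) (hm : 4 * m ≤ ∑ k ∈ nbhd T δ t, p k)
    (hlog : 12 * Real.log n ≤ m) :
    μ.real {ω | ¬ IsConcentrated w δ t m (√(112 * n / (m * L)))
      (√(11 * n * Real.log n / (2 * (m * L)))) (G ω) (y ω)} ≤ 4 * ((n : ℝ) ^ 10)⁻¹ := by
  have hn0 : (0 : ℝ) < n := Nat.cast_pos.2 hn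
  have hL0 : (0 : ℝ) < L := by exact_mod_cast hL
  have hl0 : 0 ≤ Real.log n := Real.log_natCast_nonneg n
  have hexp : ∀ k : ℕ, Real.exp (-(k * Real.log n)) = ((n : ℝ) ^ k)⁻¹ := fun k => by
    rw [Real.exp_neg, ← Real.log_pow, Real.exp_log (by positivity)]
  have h := measureReal_not_isConcentrated_le hn hL hM hw hp (x := 4 * m) (by positivity) hm
    (Real.sqrt_nonneg (112 * n / (m * L))) (Real.sqrt_nonneg (11 * n * Real.log n / (2 * (m * L))))
  rw [mul_div_cancel_left₀ m (by norm_num : (4 : ℝ) ≠ 0)] at h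
  refine h.trans ?_
  rw [Real.sq_sqrt (by positivity), Real.sq_sqrt (by positivity)]
  -- The constant 112 makes the exponent `14 n`, which beats `25 ^ n ≤ exp (4 n)` and leaves `exp
  -- (-10 n)`. The constant `11 / 2` makes the exponent `11 log n`, one power of `n` being spent on
  -- the rows.
  have e1 : 2 * (112 * n / (m * L)) * (m * L) / 16 = 14 * (n : ℝ) := by field_simp; ring
  have e2 : 2 * (11 * n * Real.log n / (2 * (m * L))) * (m * L) / n = (11 : ℕ) * Real.log n := by
    field_simp; norm_num; ring
  rw [e1, e2, hexp]
  have t1 : (n : ℝ) ^ 2 * Real.exp (-m) ≤ ((n : ℝ) ^ 10)⁻¹ := by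
    calc (n : ℝ) ^ 2 * Real.exp (-m) ≤ (n : ℝ) ^ 2 * Real.exp (-((12 : ℕ) * Real.log n)) := by
          gcongr
          exact_mod_cast hlog
      _ = _ := by rw [hexp]; field_simp
  have t2 : (25 : ℝ) ^ n * Real.exp (-(14 * n)) ≤ ((n : ℝ) ^ 10)⁻¹ := by
    have h25 : (25 : ℝ) ≤ Real.exp 4 := by
      have h1 := Real.exp_one_gt_d9
      have h2 : Real.exp 4 = Real.exp 1 ^ 4 := by rw [← Real.exp_nat_mul]; norm_num
      rw [h2]
      calc (25 : ℝ) ≤ 2.5 ^ 4 := by norm_num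
        _ ≤ _ := by gcongr; linarith
    have hlogn : Real.log n ≤ n := (Real.log_le_sub_one_of_pos hn0).trans (by linarith)
    calc (25 : ℝ) ^ n * Real.exp (-(14 * n)) ≤ Real.exp 4 ^ n * Real.exp (-(14 * n)) := by gcongr
      _ = Real.exp (-(10 * n)) := by
          rw [← Real.exp_nat_mul, ← Real.exp_add]
          ring_nf
      _ ≤ Real.exp (-((10 : ℕ) * Real.log n)) := by
          gcongr
          norm_num
      _ = _ := hexp 10
  have t3 : 2 * (n : ℝ) * ((n : ℝ) ^ 11)⁻¹ = 2 * ((n : ℝ) ^ 10)⁻¹ := by field_simp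
  rw [t3]
  linarith

end Event

/-! ### The estimator on the high-probability event -/

section Estimator

variable {n T L : ℕ}

open Classical in
/-- The off-diagonal rates of the transition matrix, before normalisation. -/
noncomputable def rate (δ t : ℝ) (g : Fin (T + 1) → SimpleGraph (Fin n))
    (z : Fin (T + 1) → Fin n → Fin n → Fin L → Bool) (i j : Fin n) : ℝ :=
  if (unionGraph δ t g).Adj i j then avgFreq δ t g z i j else 0

lemma avgFreq_mem_Icc (δ t : ℝ) (g : Fin (T + 1) → SimpleGraph (Fin n))
    (z : Fin (T + 1) → Fin n → Fin n → Fin L → Bool) (i j : Fin n) :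
    avgFreq δ t g z i j ∈ Set.Icc (0 : ℝ) 1 := by
  have h0 : 0 ≤ ∑ k ∈ pairTimes δ t g i j, winFreq z k i j :=
    Finset.sum_nonneg fun k _ => (winFreq_mem_Icc z k i j).1
  have h1 : ∑ k ∈ pairTimes δ t g i j, winFreq z k i j ≤ (pairTimes δ t g i j).card := by
    simpa using Finset.sum_le_card_nsmul _ _ _ fun k _ => (winFreq_mem_Icc z k i j).2
  unfold avgFreq
  refine ⟨by positivity, ?_⟩
  rw [one_div_mul_eq_div]
  exact div_le_one_of_le₀ h1 (Nat.cast_nonneg _)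

lemma rate_mem_Icc (δ t : ℝ) (g : Fin (T + 1) → SimpleGraph (Fin n))
    (z : Fin (T + 1) → Fin n → Fin n → Fin L → Bool) (i j : Fin n) :
    rate δ t g z i j ∈ Set.Icc (0 : ℝ) 1 := by
  unfold rate
  split_ifs
  · exact avgFreq_mem_Icc δ t g z i j
  · simp

lemma transMatrix_apply (d δ t : ℝ) (g : Fin (T + 1) → SimpleGraph (Fin n))
    (z : Fin (T + 1) → Fin n → Fin n → Fin L → Bool) (i j : Fin n) :
    transMatrix d δ t g z i j =
      (if i = j then 1 - (1 / d) * ∑ k, rate δ t g z i k else 0) + rate δ t g z i j / d := by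
  rcases eq_or_ne i j with rfl | hij
  · simp [transMatrix, rate]
  · by_cases h : (unionGraph δ t g).Adj i j <;> simp [transMatrix, rate, hij, h]

lemma transMatrix_row_sum (d δ t : ℝ) (g : Fin (T + 1) → SimpleGraph (Fin n))
    (z : Fin (T + 1) → Fin n → Fin n → Fin L → Bool) (i : Fin n) :
    ∑ j, transMatrix d δ t g z i j = 1 := by
  simp_rw [transMatrix_apply, Finset.sum_add_distrib, ← Finset.sum_div]
  simp
  ring

lemma transMatrix_nonneg {d δ t : ℝ} (hd : n ≤ d) (g : Fin (T + 1) → SimpleGraph (Fin n))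
    (z : Fin (T + 1) → Fin n → Fin n → Fin L → Bool) (i j : Fin n) :
    0 ≤ transMatrix d δ t g z i j := by
  have hn0 : (0 : ℝ) ≤ n := Nat.cast_nonneg n
  have hd0 : 0 ≤ d := hn0.trans hd
  rw [transMatrix_apply]
  refine add_nonneg ?_ (div_nonneg (rate_mem_Icc δ t g z i j).1 hd0)
  split_ifs
  · have h1 : ∑ k, rate δ t g z i k ≤ n := by
      simpa using Finset.sum_le_card_nsmul Finset.univ _ _ fun k _ => (rate_mem_Icc δ t g z i k).2
    rw [one_div_mul_eq_div, sub_nonneg]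
    exact div_le_one_of_le₀ (h1.trans hd) hd0
  · exact le_rfl

/-- The diagonal only completes the rows to 1, so the retained mass cancels and `d` factors out of
the balance. -/
lemma flux_rate_eq_zero {d δ t : ℝ} (hd : 0 < d) {g : Fin (T + 1) → SimpleGraph (Fin n)}
    {z : Fin (T + 1) → Fin n → Fin n → Fin L → Bool} {v : Fin n → ℝ}
    (hv : v ᵥ* transMatrix d δ t g z = v) (j : Fin n) : flux (rate δ t g z) v j = 0 := by
  have h := congrFun hv j
  simp only [Matrix.vecMul, dotProduct, transMatrix_apply, mul_add, Finset.sum_add_distrib,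
    mul_ite, mul_zero, Finset.sum_ite_eq', Finset.mem_univ, if_true] at h
  have e : ∑ i, v i * (rate δ t g z i j / d) = (∑ i, v i * rate δ t g z i j) / d := by
    rw [Finset.sum_div]
    exact Finset.sum_congr rfl fun i _ => by ring
  rw [e] at h
  simp only [flux, Finset.sum_sub_distrib, ← Finset.mul_sum]
  field_simp at h
  linarith

/-- The difference between the conditional mean of the averaged win frequency and the winning
probability at time `t`. -/
noncomputable def bias (w : ℝ → Fin n → ℝ) (δ t : ℝ) (g : Fin (T + 1) → SimpleGraph (Fin n))
    (i j : Fin n) : ℝ :=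
  (1 / ((pairTimes δ t g i j).card : ℝ)) *
    ∑ k ∈ pairTimes δ t g i j, (winProb w (gridPoint T k) i j - winProb w t i j)

lemma abs_bias_le {M : ℝ} {w : ℝ → Fin n → ℝ} (hM : 0 ≤ M) (hw : IsLipschitzStrength M w)
    {δ t : ℝ} (hδ : 0 ≤ δ) (ht : t ∈ Set.Icc (0 : ℝ) 1) (g : Fin (T + 1) → SimpleGraph (Fin n))
    (i j : Fin n) : |bias w δ t g i j| ≤ M * (δ / T) := by
  have hMT : 0 ≤ M * (δ / T) := by positivity
  rcases eq_or_ne i j with rfl | hij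
  · simpa [bias, pairTimes_self] using hMT
  have h : ∑ k ∈ pairTimes δ t g i j, |winProb w (gridPoint T k) i j - winProb w t i j| ≤
      (pairTimes δ t g i j).card * (M * (δ / T)) := by
    rw [← nsmul_eq_mul]
    refine Finset.sum_le_card_nsmul _ _ _ fun k hk => ?_
    have hk' : |t - gridPoint T k| ≤ δ / T := by
      simp only [pairTimes, nbhd, Finset.mem_filter] at hk
      exact hk.1.2
    refine (hw.lipschitz _ (gridPoint_mem_Icc k) t ht i j hij).trans ?_
    rw [abs_sub_comm]
    gcongr
  unfold bias
  rw [abs_mul, abs_of_nonneg (by positivity), one_div_mul_eq_div]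
  exact div_le_of_le_mul₀ (Nat.cast_nonneg _) hMT
    (((Finset.abs_sum_le_sum_abs _ _).trans h).trans_eq (mul_comm _ _))

/-- A pair with at least one comparison is an edge of the union graph; once this holds for all
pairs, the complete graph is the reference chain. -/
lemma rate_eq {w : ℝ → Fin n → ℝ} {δ t : ℝ} {g : Fin (T + 1) → SimpleGraph (Fin n)}
    {z : Fin (T + 1) → Fin n → Fin n → Fin L → Bool} {i j : Fin n}
    (h : 0 < ((pairTimes δ t g i j).card : ℝ)) :
    rate δ t g z i j = w t j / (w t i + w t j) + (bias w δ t g i j + noise w δ t g z i j) := by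
  have hadj : (unionGraph δ t g).Adj i j := by
    obtain ⟨k, hk⟩ := Finset.card_pos.1 (Nat.cast_pos.1 h)
    simp only [pairTimes, Finset.mem_filter] at hk
    simp only [unionGraph, SimpleGraph.iSup_adj]
    exact ⟨k, hk.1, hk.2⟩
  rw [rate, if_pos hadj, avgFreq, bias, noise, ← mul_add, ← Finset.sum_add_distrib]
  have : ∀ k, winProb w (gridPoint T k) i j - winProb w t i j +
      (winFreq z k i j - winProb w (gridPoint T k) i j) = winFreq z k i j - winProb w t i j :=
    fun k => by ring
  simp_rw [this, Finset.sum_sub_distrib, Finset.sum_const, nsmul_eq_mul]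
  change _ = winProb w t i j + _
  field_simp
  ring

lemma le_ratioMax_mul {w : ℝ → Fin n → ℝ} {t : ℝ} (hw : ∀ i, 0 < w t i) (i j : Fin n) :
    w t i ≤ ratioMax w t * w t j := by
  rw [← div_le_iff₀ (hw j)]
  exact le_ciSup (f := fun ij : Fin n × Fin n => w t ij.1 / w t ij.2) (Finite.bddAbove_range _)
    (i, j)

theorem IsConcentrated.l2norm_sub_le {M : ℝ} {w : ℝ → Fin n → ℝ} (hn : 0 < n) (hL : 1 ≤ L)
    (hM : 0 ≤ M) (hw : IsLipschitzStrength M w) {d δ t m s s' : ℝ} (hd : 0 < d) (hδ : 0 ≤ δ)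
    (ht : t ∈ Set.Icc (0 : ℝ) 1) (hm : 0 < m) {g : Fin (T + 1) → SimpleGraph (Fin n)}
    {z : Fin (T + 1) → Fin n → Fin n → Fin L → Bool}
    (hz : ∀ k i j l, i ≠ j → z k j i l = !(z k i j l)) (hc : IsConcentrated w δ t m s s' g z)
    (hsmall : 4 * ratioMax w t ^ 2 * (2 * n * (M * (δ / T)) + s + s') ≤ n) {v : Fin n → ℝ}
    (hv : IsStationaryDist (transMatrix d δ t g z) v) :
    n * l2norm (v - piStar w t) ≤ 4 * ratioMax w t ^ 2 *
      (2 * n * (M * (δ / T)) + (s + ratioMax w t * s)) * l2norm (piStar w t) :=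
  l2norm_sub_le_of_flux_eq_zero (w := w t) hn (hw.pos t ht) (le_ratioMax_mul (hw.pos t ht))
    (fun i j hij => rate_eq (hm.trans_le (hc.le_card i j hij)))
    (abs_bias_le hM hw hδ ht g) (noise_antisymm hL hw.pos hz δ t g) hc.opNorm_le hc.abs_row_le
    hsmall hv.sum_eq_one (flux_rate_eq_zero hd hv.stationary)

end Estimator

/-! ### The optimal neighbourhood size and the error bound -/

section Bounds

variable {n T L : ℕ} {M b q : ℝ}

lemma one_le_ratioMax {w : ℝ → Fin n → ℝ} {t : ℝ} (hn : 0 < n) (hw : ∀ i, 0 < w t i) :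
    1 ≤ ratioMax w t := by
  have i : Fin n := ⟨0, hn⟩
  have := le_ratioMax_mul hw i i
  exact le_of_mul_le_mul_right (by linarith) (hw i)

lemma deltaStar_pos (hn : 0 < n) (hT : 0 < T) (hL : 0 < L) (hM : 0 ≤ M) (hb : 0 < b) (hq : 0 < q) :
    0 < deltaStar n T L M b q := by
  unfold deltaStar
  have hn0 : (0 : ℝ) < n := Nat.cast_pos.2 hn
  have hT0 : (0 : ℝ) < T := Nat.cast_pos.2 hT
  have hL0 : (0 : ℝ) < L := Nat.cast_pos.2 hL
  split_ifs with h
  · exact hT0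
  · have hM0 : 0 < M := lt_of_le_of_ne hM (Ne.symm h)
    positivity

lemma biasFactor_eq (hT : 0 < T) : biasFactor n T L M b q = deltaStar n T L M b q / T := by
  have hT0 : (0 : ℝ) < T := Nat.cast_pos.2 hT
  unfold biasFactor deltaStar
  split_ifs with h
  · rw [div_self hT0.ne']
  · rw [← min_div_div_right hT0.le, div_self hT0.ne', mul_div_assoc]
    congr 1
    have e : (T : ℝ) ^ (2 / 3 : ℝ) / T = 1 / (T : ℝ) ^ (1 / 3 : ℝ) := by
      rw [div_eq_div_iff hT0.ne' (by positivity), ← Real.rpow_add hT0]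
      norm_num
    rw [e, div_mul_div_comm, mul_one]

/-- The first entry of the minimum is the inverse square of the first entry of the maximum, and `x ↦
1 / √x` exchanges minimum and maximum. -/
lemma varFactor_eq (hn : 0 < n) (hT : 0 < T) (hL : 0 < L) (hM : 0 ≤ M) (hb : 0 < b) (hq : 0 < q) :
    varFactor n T L M b q = 1 / √(deltaStar n T L M b q) := by
  have hn0 : (0 : ℝ) < n := Nat.cast_pos.2 hn
  have hT0 : (0 : ℝ) < T := Nat.cast_pos.2 hT
  have hL0 : (0 : ℝ) < L := Nat.cast_pos.2 hL
  unfold varFactor deltaStar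
  split_ifs with h
  · subst h
    -- For `M = 0` the first entry of the maximum is 0, consistent with the convention `δ* = T`.
    rw [mul_zero, Real.zero_rpow (by norm_num), zero_mul, zero_mul, zero_div]
    exact max_eq_right (by positivity)
  have hM0 : 0 < M := lt_of_le_of_ne hM (Ne.symm h)
  have hsq : ∀ x : ℝ, 0 < x → ∀ r : ℝ, x ^ (2 * r) = (x ^ r) ^ 2 := fun x hx r => by
    rw [mul_comm, Real.rpow_mul hx.le, Real.rpow_two]
  have e1 : b ^ (2 / 3 : ℝ) / ((2 * M) ^ (2 / 3 : ℝ) * n * (L * q) ^ (1 / 3 : ℝ)) *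
      (T : ℝ) ^ (2 / 3 : ℝ) = (1 / ((2 * M) ^ (1 / 3 : ℝ) * (n : ℝ) ^ (1 / 2 : ℝ) *
        (L * q) ^ (1 / 6 : ℝ) / (b ^ (1 / 3 : ℝ) * (T : ℝ) ^ (1 / 3 : ℝ)))) ^ 2 := by
    have a1 := hsq b hb (1 / 3)
    have a2 := hsq (2 * M) (by positivity) (1 / 3)
    have a3 := hsq T hT0 (1 / 3)
    have a4 := hsq (L * q) (by positivity) (1 / 6)
    have a5 := hsq n hn0 (1 / 2)
    norm_num at a1 a2 a3 a4 a5
    rw [a1, a2, a3]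
    norm_num
    rw [a4]
    nth_rewrite 1 [a5]
    field_simp
  rw [e1]
  set X := (2 * M) ^ (1 / 3 : ℝ) * (n : ℝ) ^ (1 / 2 : ℝ) *
        (L * q) ^ (1 / 6 : ℝ) / (b ^ (1 / 3 : ℝ) * (T : ℝ) ^ (1 / 3 : ℝ)) with hX
  have hX0 : 0 < X := by positivity
  have hsT : 0 < √(T : ℝ) := Real.sqrt_pos.2 hT0
  have e2 : √(min ((1 / X) ^ 2) (T : ℝ)) = min (1 / X) (√T) := by
    rw [Monotone.map_min (fun _ _ h => Real.sqrt_le_sqrt h : Monotone Real.sqrt), Real.sqrt_sq (by positivity)]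
  rw [e2]
  rcases le_total (1 / X) (√(T : ℝ)) with hle | hle
  · rw [min_eq_left hle, one_div_one_div, max_eq_left]
    rw [one_div_le hsT hX0]
    exact hle
  · rw [min_eq_right hle, max_eq_right]
    rw [le_one_div hX0 hsT]
    exact hle

lemma errBound_eq_of_eq_zero : errBound n T L 0 b q = b ^ (9 / 2 : ℝ) / √((L : ℝ) * n * q * T) := by
  unfold errBound varFactor
  rw [mul_zero, Real.zero_rpow (by norm_num)]
  simp only [zero_mul, zero_div, zero_add]
  rw [max_eq_right (by positivity), div_mul_div_comm, mul_one,
    ← Real.sqrt_mul' _ (Nat.cast_nonneg T)]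

/-- Bound the minimum by its first entry and the maximum by the sum. The bias and the first variance
term then have the same form, as `25/6 = 7/2 + 2/3 = 9/2 - 1/3`; they contribute 1 and 2 to the
constant 3. -/
lemma errBound_le_of_pos (hn : 0 < n) (hT : 0 < T) (hL : 0 < L) (hM : 0 < M) (hb : 0 < b)
    (hq : 0 < q) : errBound n T L M b q ≤ 3 * ((M ^ (1 / 3 : ℝ) * b ^ (25 / 6 : ℝ)
        / ((L : ℝ) * q) ^ (1 / 3 : ℝ) + b ^ (9 / 2 : ℝ) / √((L : ℝ) * n * q))
      * (T : ℝ) ^ (-(1 / 3) : ℝ)) := by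
  have hn0 : (0 : ℝ) < n := Nat.cast_pos.2 hn
  have hT0 : (0 : ℝ) < T := Nat.cast_pos.2 hT
  have hL0 : (0 : ℝ) < L := Nat.cast_pos.2 hL
  have hT1 : (1 : ℝ) ≤ T := by exact_mod_cast hT
  set τ := (T : ℝ) ^ (1 / 3 : ℝ) with hτ
  have hτ0 : 0 < τ := by positivity
  set Y := M ^ (1 / 3 : ℝ) with hY
  have hY0 : 0 < Y := by positivity
  set Q := ((L : ℝ) * q) ^ (1 / 6 : ℝ) with hQ
  have hQ0 : 0 < Q := by positivity
  set β := b ^ (25 / 6 : ℝ) with hβ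
  have hβ0 : 0 < β := by positivity
  have hQ2 : ((L : ℝ) * q) ^ (1 / 3 : ℝ) = Q ^ 2 := by
    rw [hQ, ← Real.rpow_natCast, ← Real.rpow_mul (by positivity)]
    norm_num
  have hQ3 : √((L : ℝ) * n * q) = (n : ℝ) ^ (1 / 2 : ℝ) * Q ^ 3 := by
    rw [hQ, ← Real.rpow_natCast _ 3, ← Real.rpow_mul (by positivity), Real.sqrt_eq_rpow,
      show (L : ℝ) * n * q = n * (L * q) by ring, Real.mul_rpow hn0.le (by positivity)]
    norm_num
  have hY3 : M = Y ^ 3 := by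
    rw [hY, ← Real.rpow_natCast, ← Real.rpow_mul hM.le]
    norm_num
  have hMY2 : Y ^ 2 ≤ (2 * M) ^ (2 / 3 : ℝ) := by
    rw [hY, ← Real.rpow_natCast, ← Real.rpow_mul hM.le]
    norm_num
    exact Real.rpow_le_rpow hM.le (by linarith) (by norm_num)
  have hMY1 : (2 * M) ^ (1 / 3 : ℝ) ≤ 2 * Y := by
    rw [Real.mul_rpow (by norm_num) hM.le]
    gcongr
    calc (2 : ℝ) ^ (1 / 3 : ℝ) ≤ 2 ^ (1 : ℝ) :=
          Real.rpow_le_rpow_of_exponent_le (by norm_num) (by norm_num)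
      _ = 2 := Real.rpow_one 2
  have hβ1 : b ^ (7 / 2 : ℝ) * b ^ (2 / 3 : ℝ) = β := by
    rw [hβ, ← Real.rpow_add hb]
    norm_num
  have hβ2 : b ^ (9 / 2 : ℝ) = β * b ^ (1 / 3 : ℝ) := by
    rw [hβ, ← Real.rpow_add hb]
    norm_num
  have hτ' : (T : ℝ) ^ (-(1 / 3) : ℝ) = 1 / τ := by
    rw [Real.rpow_neg hT0.le, one_div τ]
  have hτT : 1 / √(T : ℝ) ≤ 1 / τ := by
    rw [Real.sqrt_eq_rpow]
    exact one_div_le_one_div_of_le hτ0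
      (Real.rpow_le_rpow_of_exponent_le hT1 (by norm_num))
  have h1 : M * n * b ^ (7 / 2 : ℝ) * biasFactor n T L M b q ≤ Y * β / Q ^ 2 * (1 / τ) := by
    have hbf : biasFactor n T L M b q ≤ b ^ (2 / 3 : ℝ) / (Y ^ 2 * n * Q ^ 2 * τ) := by
      rw [biasFactor, if_neg hM.ne', hQ2]
      refine (min_le_left _ _).trans ?_
      gcongr
    calc _ ≤ M * n * b ^ (7 / 2 : ℝ) * (b ^ (2 / 3 : ℝ) / (Y ^ 2 * n * Q ^ 2 * τ)) := by gcongr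
      _ = (b ^ (7 / 2 : ℝ) * b ^ (2 / 3 : ℝ)) * M / (Y ^ 2 * Q ^ 2 * τ) := by field_simp
      _ = _ := by
          rw [hβ1, hY3]
          field_simp
  have h2 : b ^ (9 / 2 : ℝ) / √((L : ℝ) * n * q) * varFactor n T L M b q ≤
      2 * (Y * β / Q ^ 2 * (1 / τ)) + b ^ (9 / 2 : ℝ) / √((L : ℝ) * n * q) * (1 / τ) := by
    have hvf : varFactor n T L M b q ≤
        2 * Y * (n : ℝ) ^ (1 / 2 : ℝ) * Q / (b ^ (1 / 3 : ℝ) * τ) + 1 / τ := by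
      refine (max_le_add_of_nonneg (by positivity) (by positivity)).trans ?_
      gcongr
    calc _ ≤ b ^ (9 / 2 : ℝ) / √((L : ℝ) * n * q) *
          (2 * Y * (n : ℝ) ^ (1 / 2 : ℝ) * Q / (b ^ (1 / 3 : ℝ) * τ) + 1 / τ) := by gcongr
      _ = b ^ (9 / 2 : ℝ) / √((L : ℝ) * n * q) *
          (2 * Y * (n : ℝ) ^ (1 / 2 : ℝ) * Q / (b ^ (1 / 3 : ℝ) * τ)) +
          b ^ (9 / 2 : ℝ) / √((L : ℝ) * n * q) * (1 / τ) := mul_add _ _ _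
      _ = _ := by
          congr 1
          rw [hβ2, hQ3]
          field_simp
  have h3 : 0 ≤ b ^ (9 / 2 : ℝ) / √((L : ℝ) * n * q) * (1 / τ) := by positivity
  rw [hQ2, hτ']
  unfold errBound
  linarith

end Bounds

lemma half_le_log_natCast {n : ℕ} (hn : 2 ≤ n) : 1 / 2 ≤ Real.log n := by
  have h1 : Real.log 2 ≤ Real.log n := Real.log_le_log (by norm_num) (by exact_mod_cast hn)
  linarith [Real.log_two_gt_d9]

/-- The thresholds of the concentration event, compared with the terms of the error bound. -/
lemma threshold_bounds {n L : ℕ} {κ q δ D : ℝ} (hn : 2 ≤ n) (hL : 0 < L) (hκ : 1 ≤ κ) (hq : 0 < q)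
    (hD : 0 < D) (hδ : D / κ ≤ δ) :
    √(112 * n / (q * δ / 8 * L)) ≤ n * (30 * κ * (1 / √((L : ℝ) * n * q) * (1 / √D))) ∧
    √(112 * n / (q * δ / 8 * L)) + √(11 * n * Real.log n / (2 * (q * δ / 8 * L))) ≤
      n * (50 * κ * (√(Real.log n / ((L : ℝ) * n * q)) * (1 / √D))) := by
  have hn0 : (0 : ℝ) < n := by positivity
  have hL0 : (0 : ℝ) < L := Nat.cast_pos.2 hL
  have hκ0 : 0 < κ := by linarith
  have hδ0 : 0 < δ := (div_pos hD hκ0).trans_le hδ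
  have hl := half_le_log_natCast hn
  -- Weakening `κ` to `κ ^ 2` lets it leave the square root as `κ`; below, `112 * 8 = 896` and `44`
  -- are likewise rounded up to the squares of 30 and 7.
  have hDδ : 1 / δ ≤ κ ^ 2 * (1 / D) := by
    have h1 : 1 / δ ≤ 1 / (D / κ) := one_div_le_one_div_of_le (by positivity) hδ
    have h2 : 1 / (D / κ) = κ * (1 / D) := by field_simp
    have h3 : κ * (1 / D) ≤ κ ^ 2 * (1 / D) := by
      gcongr
      nlinarith
    linarith
  have hA : (1 / √((L : ℝ) * n * q) * (1 / √D)) = √(1 / (L * n * q) * (1 / D)) := by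
    rw [Real.sqrt_mul (x := 1 / ((L : ℝ) * n * q)) (by positivity), Real.sqrt_div zero_le_one,
      Real.sqrt_div zero_le_one, Real.sqrt_one]
  have hB : √(Real.log n / ((L : ℝ) * n * q)) * (1 / √D) =
      √(Real.log n / (L * n * q) * (1 / D)) := by
    rw [Real.sqrt_mul (by positivity), Real.sqrt_div zero_le_one D, Real.sqrt_one]
  have hs : √(112 * n / (q * δ / 8 * L)) ≤
      n * (30 * κ * √(1 / (L * n * q) * (1 / D))) := by
    refine Real.sqrt_le_iff.2 ⟨by positivity, ?_⟩
    rw [mul_pow, mul_pow, Real.sq_sqrt (by positivity)]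
    calc 112 * n / (q * δ / 8 * L) = 896 * n / (q * L) * (1 / δ) := by field_simp; norm_num
      _ ≤ 896 * n / (q * L) * (κ ^ 2 * (1 / D)) := by gcongr
      _ ≤ 900 * n / (q * L) * (κ ^ 2 * (1 / D)) := by gcongr; norm_num
      _ = _ := by field_simp; norm_num
  have hs' : √(11 * n * Real.log n / (2 * (q * δ / 8 * L))) ≤
      n * (7 * κ * √(Real.log n / (L * n * q) * (1 / D))) := by
    refine Real.sqrt_le_iff.2 ⟨by positivity, ?_⟩
    rw [mul_pow, mul_pow, Real.sq_sqrt (by positivity)]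
    calc 11 * n * Real.log n / (2 * (q * δ / 8 * L)) =
          44 * n * Real.log n / (q * L) * (1 / δ) := by field_simp; norm_num
      _ ≤ 44 * n * Real.log n / (q * L) * (κ ^ 2 * (1 / D)) := by gcongr
      _ ≤ 49 * n * Real.log n / (q * L) * (κ ^ 2 * (1 / D)) := by gcongr; norm_num
      _ = _ := by field_simp; norm_num
  -- Since `log n ≥ 1/2` and `43/30 ≥ √2`, the operator norm threshold is absorbed, and `43 + 7 =
  -- 50`.
  have hAB : 30 * √(1 / (L * n * q) * (1 / D)) ≤ 43 * √(Real.log n / (L * n * q) * (1 / D)) := by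
    have h43 : √(1 / ((L : ℝ) * n * q) * (1 / D)) ≤
        43 / 30 * √(Real.log n / (L * n * q) * (1 / D)) := by
      refine Real.sqrt_le_iff.2 ⟨by positivity, ?_⟩
      rw [mul_pow, Real.sq_sqrt (by positivity)]
      calc 1 / ((L : ℝ) * n * q) * (1 / D) ≤
            (43 / 30) ^ 2 * Real.log n / (L * n * q) * (1 / D) := by
              gcongr
              linarith
        _ = _ := by ring
    linarith
  rw [hA, hB]
  refine ⟨hs, ?_⟩
  have : n * κ * (30 * √(1 / (L * n * q) * (1 / D))) ≤
      n * κ * (43 * √(Real.log n / (L * n * q) * (1 / D))) := by gcongr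
  linarith

/-- The deterministic error bound on the concentration event. -/
lemma l2norm_div_le_errBound {n T L : ℕ} {κ M : ℝ} (hκ : 1 ≤ κ) (hn : 2 ≤ n) (hT : 0 < T)
    (hL : 1 ≤ L) (hM : 0 ≤ M) {w : ℝ → Fin n → ℝ} (hw : IsLipschitzStrength M w) {q δ t d : ℝ}
    (hq : 0 < q) (hd : 0 < d) (ht : t ∈ Set.Icc (0 : ℝ) 1)
    (hδ1 : deltaStar n T L M (ratioMax w t) q / κ ≤ δ)
    (hδ2 : δ ≤ κ * deltaStar n T L M (ratioMax w t) q)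
    (hcond : condLHS n T L M (ratioMax w t) q ≤ 1 / (200 * κ) / ratioMax w t ^ (7 / 2 : ℝ))
    {g : Fin (T + 1) → SimpleGraph (Fin n)} {z : Fin (T + 1) → Fin n → Fin n → Fin L → Bool}
    (hz : ∀ k i j l, i ≠ j → z k j i l = !(z k i j l))
    (hc : IsConcentrated w δ t (q * δ / 8) (√(112 * n / (q * δ / 8 * L)))
      (√(11 * n * Real.log n / (2 * (q * δ / 8 * L)))) g z)
    {v : Fin n → ℝ} (hv : IsStationaryDist (transMatrix d δ t g z) v) :
    l2norm (v - piStar w t) / l2norm (piStar w t) ≤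
      240 * κ * errBound n T L M (ratioMax w t) q := by
  have hn1 : 0 < n := by omega
  have hn0 : (0 : ℝ) < n := by positivity
  have hn1' : (1 : ℝ) ≤ n := by exact_mod_cast hn1
  have hT0 : (0 : ℝ) < T := Nat.cast_pos.2 hT
  have hL0 : (0 : ℝ) < L := by exact_mod_cast hL
  have hκ0 : 0 < κ := by linarith
  have hb1 := one_le_ratioMax hn1 (hw.pos t ht)
  set b := ratioMax w t with hb
  have hb0 : 0 < b := by linarith
  have hD := deltaStar_pos hn1 hT hL hM hb0 hq
  have hvar := varFactor_eq hn1 hT hL hM hb0 hq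
  have hbias := biasFactor_eq (n := n) (L := L) (M := M) (b := b) (q := q) hT
  unfold condLHS at hcond
  unfold errBound
  set D := deltaStar n T L M b q with hDdef
  rw [hvar, hbias] at hcond ⊢
  have hδ0 : 0 < δ := (div_pos hD hκ0).trans_le hδ1
  obtain ⟨hs, hss'⟩ := threshold_bounds hn hL hκ hq hD hδ1
  set s := √(112 * n / (q * δ / 8 * L)) with hsdef
  set s' := √(11 * n * Real.log n / (2 * (q * δ / 8 * L))) with hs'def
  set A := 1 / √((L : ℝ) * n * q) * (1 / √D) with hA
  set A' := √(Real.log n / ((L : ℝ) * n * q)) * (1 / √D) with hA'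
  have hA0 : 0 ≤ A := by positivity
  have hA'0 : 0 ≤ A' := by positivity
  -- The bias enters without a factor `n`; the one in the error bound is slack, as are the powers of
  -- `b` above 2 and 3.
  have hη : M * (δ / T) ≤ κ * (M * n * (D / T)) := by
    calc M * (δ / T) ≤ M * (κ * D / T) * 1 := by rw [mul_one]; gcongr
      _ ≤ M * (κ * D / T) * n := by gcongr
      _ = _ := by ring
  have hpow : ∀ (k : ℕ) (r : ℝ), (k : ℝ) ≤ r → b ^ k ≤ b ^ r := fun k r hkr => by
    rw [← Real.rpow_natCast]
    exact Real.rpow_le_rpow_of_exponent_le hb1 hkr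
  have hb2 : b ^ 2 ≤ b ^ (7 / 2 : ℝ) := hpow 2 _ (by norm_num)
  have hb3 : b ^ 3 ≤ b ^ (9 / 2 : ℝ) := hpow 3 _ (by norm_num)
  have hsmall : 4 * b ^ 2 * (2 * n * (M * (δ / T)) + s + s') ≤ n := by
    have h1 : 2 * n * (M * (δ / T)) + s + s' ≤ n * (50 * κ * (A' + M * n * (D / T))) := by
      have : n * (2 * (M * (δ / T))) ≤ n * (50 * κ * (M * n * (D / T))) := by
        have h0 : 0 ≤ κ * (M * n * (D / T)) := by positivity
        refine mul_le_mul_of_nonneg_left ?_ hn0.le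
        linarith
      linarith
    -- This fixes `c₃ = 1 / (200 κ)`: the resulting `1/4` cancels the 4 in the smallness condition.
    have h2 : 50 * κ * (A' + M * n * (D / T)) ≤ 1 / 4 / b ^ (7 / 2 : ℝ) := by
      calc _ ≤ 50 * κ * (1 / (200 * κ) / b ^ (7 / 2 : ℝ)) := by gcongr
        _ = _ := by field_simp; norm_num
    calc _ ≤ 4 * b ^ 2 * (n * (1 / 4 / b ^ (7 / 2 : ℝ))) := by
          have h3 : n * (50 * κ * (A' + M * n * (D / T))) ≤ n * (1 / 4 / b ^ (7 / 2 : ℝ)) := by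
            gcongr
          have h4 := h1.trans h3
          gcongr
      _ ≤ 4 * b ^ (7 / 2 : ℝ) * (n * (1 / 4 / b ^ (7 / 2 : ℝ))) := by gcongr
      _ = n := by field_simp
  have hmain := hc.l2norm_sub_le hn1 hL hM hw hd hδ0.le ht (by positivity) hz hsmall hv
  have hbound : 4 * b ^ 2 * (2 * n * (M * (δ / T)) + (s + b * s)) ≤
      n * (240 * κ * (M * n * b ^ (7 / 2 : ℝ) * (D / T) +
        b ^ (9 / 2 : ℝ) / √((L : ℝ) * n * q) * (1 / √D))) := by
    have h1 : s + b * s ≤ 2 * b * (n * (30 * κ * A)) := by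
      have h1 : b * s ≤ b * (n * (30 * κ * A)) := by gcongr
      have h2 : 1 * s ≤ b * s := by gcongr
      linarith
    have h2 : 2 * n * (M * (δ / T)) ≤ 2 * n * (κ * (M * n * (D / T))) := by
      exact mul_le_mul_of_nonneg_left hη (by positivity)
    calc _ ≤ 4 * b ^ 2 * (2 * n * (κ * (M * n * (D / T))) + 2 * b * (n * (30 * κ * A))) := by
          gcongr
      _ = n * κ * (8 * (b ^ 2 * (M * n * (D / T))) + 240 * (b ^ 3 * A)) := by ring
      _ ≤ n * κ * (240 * (b ^ (7 / 2 : ℝ) * (M * n * (D / T))) + 240 * (b ^ (9 / 2 : ℝ) * A)) := by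
          gcongr
          norm_num
      _ = _ := by rw [hA]; ring
  have hπ0 : 0 ≤ l2norm (piStar w t) := l2norm_nonneg _
  refine div_le_of_le_mul₀ hπ0 (by positivity) ?_
  refine le_of_mul_le_mul_left ?_ hn0
  calc _ ≤ _ := hmain
    _ ≤ n * (240 * κ * (M * n * b ^ (7 / 2 : ℝ) * (D / T) +
        b ^ (9 / 2 : ℝ) / √((L : ℝ) * n * q) * (1 / √D))) * l2norm (piStar w t) := by gcongr
    _ = _ := by ring

end DynRank

theorem corollary1 (κ : ℝ) (hκ : 1 ≤ κ) :
    ∃ c₁ c₂ c₃ C K : ℝ, 0 < c₁ ∧ 0 < c₂ ∧ 0 < c₃ ∧ 0 < C ∧ 0 < K ∧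
      ∀ (n T L : ℕ), 1 ≤ n → 1 ≤ T → 1 ≤ L →
      ∀ (M : ℝ), 0 ≤ M →
      ∀ (w : ℝ → Fin n → ℝ), IsLipschitzStrength M w →
      ∀ (p : Fin (T + 1) → ℝ), (∀ k, p k ≤ 1) → 0 < pMin p →
      ∀ (Ω : Type*) [MeasurableSpace Ω] (μ : Measure Ω) [IsProbabilityMeasure μ]
        (G : Ω → Fin (T + 1) → SimpleGraph (Fin n))
        (y : Ω → Fin (T + 1) → Fin n → Fin n → Fin L → Bool),
        IsDynamicBTL μ w p G y →
      ∀ t ∈ Set.Icc (0 : ℝ) 1,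
      ∀ δ : ℝ, δ ≤ T →
        deltaStar n T L M (ratioMax w t) (pMin p) / κ ≤ δ →
        δ ≤ κ * deltaStar n T L M (ratioMax w t) (pMin p) →
        c₁ * Real.log n ≤ n →
        c₂ * (Real.log n / pMin p) ≤ δ →
        condLHS n T L M (ratioMax w t) (pMin p) ≤ c₃ / ratioMax w t ^ (7 / 2 : ℝ) →
        1 - K * ((n : ℝ) ^ 10)⁻¹ ≤ μ.real {ω |
          (∃ v, IsStationaryDist (transMatrix (3 * n * pUnion p δ t) δ t (G ω) (y ω)) v) ∧
          ∀ v, IsStationaryDist (transMatrix (3 * n * pUnion p δ t) δ t (G ω) (y ω)) v →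
            l2norm (v - piStar w t) / l2norm (piStar w t)
                ≤ C * errBound n T L M (ratioMax w t) (pMin p) ∧
            (0 < M → l2norm (v - piStar w t) / l2norm (piStar w t)
                ≤ C * (M ^ (1 / 3 : ℝ) * ratioMax w t ^ (25 / 6 : ℝ)
                      / ((L : ℝ) * pMin p) ^ (1 / 3 : ℝ)
                    + ratioMax w t ^ (9 / 2 : ℝ) / √((L : ℝ) * n * pMin p))
                  * (T : ℝ) ^ (-(1 / 3) : ℝ)) ∧
            (M = 0 → l2norm (v - piStar w t) / l2norm (piStar w t)
                ≤ C * (ratioMax w t ^ (9 / 2 : ℝ) / √((L : ℝ) * n * pMin p * T)))} := by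
  have hκ0 : 0 < κ := by linarith
  -- `96 = 8 * 12` gives `m = q δ / 8 ≥ 12 log n`; `720 = 3 * 240` covers the factor 3 of
  -- `errBound_le_of_pos`; 4 is the failure constant.
  refine ⟨1, 96, 1 / (200 * κ), 720 * κ, 4, by norm_num, by norm_num, by positivity, by positivity,
    by norm_num, ?_⟩
  intro n T L hn hT hL M hM w hw p hp hq Ω _ μ _ G y hmodel t ht δ hδT hδ1 hδ2 _ hδlog hcond
  -- For `n = 1` the claimed probability `1 - 4` is negative.
  rcases hn.eq_or_lt with rfl | hn2
  · refine le_trans ?_ measureReal_nonneg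
    norm_num
  have hn2 : 2 ≤ n := hn2
  have hn0 : (0 : ℝ) < n := by positivity
  set q := pMin p with hqdef
  set b := ratioMax w t with hb
  have hb0 : 0 < b := by linarith [one_le_ratioMax hn (hw.pos t ht)]
  have hp0 : ∀ k, 0 ≤ p k := fun k => hq.le.trans (pMin_le p k)
  have hq1 : q ≤ 1 := (pMin_le p 0).trans (hp 0)
  have hl := half_le_log_natCast hn2
  have hqδ : 96 * Real.log n ≤ q * δ := by
    have := mul_le_mul_of_nonneg_left hδlog hq.le
    calc 96 * Real.log n = q * (96 * (Real.log n / q)) := by field_simp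
      _ ≤ _ := this
  have hδ0 : 0 < δ := pos_of_mul_pos_right (by linarith) hq.le
  have hδ48 : 48 ≤ δ := by
    have : q * δ ≤ 1 * δ := by gcongr
    linarith
  have hsum : 4 * (q * δ / 8) ≤ ∑ k ∈ nbhd T δ t, p k := by
    have h1 : q * (δ / 2) ≤ q * (nbhd T δ t).card := by
      gcongr
      exact half_le_card_nbhd hT ht (by linarith) hδT
    linarith [pMin_mul_card_le p (nbhd T δ t)]
  have hP : 1 / 2 ≤ pUnion p δ t := half_le_pUnion hp (by linarith)
  have hd : (n : ℝ) ≤ 3 * n * pUnion p δ t := by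
    have : 3 * (n : ℝ) * (1 / 2) ≤ 3 * n * pUnion p δ t := by gcongr
    linarith
  have hprob := measureReal_not_isConcentrated_le_pow (p := p) hn hL hmodel hw.pos hp0
    (δ := δ) (t := t) (m := q * δ / 8) (by positivity) hsum (by linarith)
  set good : Set Ω := {ω | IsConcentrated w δ t (q * δ / 8) (√(112 * n / (q * δ / 8 * L)))
      (√(11 * n * Real.log n / (2 * (q * δ / 8 * L)))) (G ω) (y ω)} with hgood
  -- Subadditivity alone suffices here, so `good` need not be shown measurable.
  have hcompl : 1 ≤ μ.real good + μ.real goodᶜ := by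
    rw [← probReal_univ (μ := μ), ← Set.union_compl_self good]
    exact measureReal_union_le _ _
  have hbad : μ.real goodᶜ ≤ 4 * ((n : ℝ) ^ 10)⁻¹ := hprob
  refine le_trans (by linarith) (measureReal_mono (μ := μ) (s₁ := good) ?_ (measure_ne_top _ _))
  intro ω hω
  refine ⟨exists_isStationaryDist hn (transMatrix_nonneg hd (G ω) (y ω))
    (transMatrix_row_sum _ δ t (G ω) (y ω)), fun v hv => ?_⟩
  have herr := l2norm_div_le_errBound hκ hn2 hT hL hM hw hq (hn0.trans_le hd) ht hδ1 hδ2 hcond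
    (hmodel.win_swap ω) hω hv
  rw [← hb] at herr
  have herr0 : 0 ≤ 240 * κ * errBound n T L M b q :=
    (div_nonneg (l2norm_nonneg _) (l2norm_nonneg _)).trans herr
  refine ⟨by linarith, fun hM0 => ?_, ?_⟩
  · have h := errBound_le_of_pos hn hT hL hM0 hb0 hq
    calc _ ≤ _ := herr
      _ ≤ 240 * κ * (3 * _) := mul_le_mul_of_nonneg_left h (by positivity)
      _ = _ := by ring
  · rintro rfl
    rw [errBound_eq_of_eq_zero] at herr herr0
    linarith
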